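/- Let $n,k\ge 0$, let $\mathcal S\subset[1,n]$, and let $V(n,k)$ be the set of I-states, i.e. $k$-element subsets of $[0,n]=\{0,\dots,n\}$. For $\mathbf x,\mathbf y\in V(n,k)$ and $1\le i\le n$ put $v_i(\mathbf x,\mathbf y)=|\mathbf y\cap[i,n]|-|\mathbf x\cap[i,n]|$ and $|v|_i=|v_i|$. The algebra $\mathcal B_0(n,k)$ is the free $\mathbb F_2[U_1,\dots,U_n]$-module on generators $f_{\mathbf x,\mathbf y}$ ($\mathbf x,\mathbf y\in V(n,k)$), with multiplication $$f_{\mathbf x,\mathbf y}f_{\mathbf y,\mathbf z}=\prod_{i=1}^n U_i^{(|v|_i(\mathbf y,\mathbf z)-|v|_i(\mathbf x,\mathbf z)+|v|_i(\mathbf x,\mathbf y))/2}\,f_{\mathbf x,\mathbf z},\qquad f_{\mathbf x,\mathbf y}f_{\mathbf y',\mathbf z}=0\ \text{ if }\mathbf y\ne\mathbf y',$$ and idempotents $\mathbf I_{\mathbf x}=f_{\mathbf x,\mathbf x}$, $1=\sum_{\mathbf x}\mathbf I_{\mathbf x}$. Let $R_i$ be the sum of the $f_{\mathbf x,\mathbf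 y}$ over all $\mathbf x$ with $\mathbf x\cap\{i-1,i\}=\{i-1\}$ and $\mathbf y=(\mathbf x\setminus\{i-1\})\cup\{i\}$; let $L_i$ be the sum of the $f_{\mathbf x,\mathbf y}$ over all $\mathbf x$ with $\mathbf x\cap\{i-1,i\}=\{i\}$ and $\mathbf y=(\mathbf x\setminus\{i\})\cup\{i-1\}$. The algebra $\mathcal B(n,k)$ is the quotient of $\mathcal B_0(n,k)$ by the two-sided ideal generated by $R_iR_{i+1}$ and $L_{i+1}L_i$ ($1\le i\le n-1$) and by $\mathbf I_{\mathbf x}U_i$ for $\mathbf x\cap\{i-1,i\}=\varnothing$. The differential algebra $\mathcal B(n,k,\mathcal S)$ is the tensor product over $\mathbb F_2$ of $\mathcal B(n,k)$ with the exterior algebra $\mathbb F_2[C_i\mid i\in\mathcal S]/(C_i^2)$; its differential $\partial$ is the derivation that vanishes on $\mathcal B(n,k)$ and satisfies $\partial C_i=U_i$. Let $H_*(\mathcal B(n,k,\mathcal S))=\ker\partial/\operatorname{im}\partial$. For $\mathbf x,\mathbf y\in V(n,k)$, let $$\phi:\mathbb F_2[U_1,\dots,U_n]\otimes\mathbb F_2[C_i\mid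 i\in\mathcal S]/(C_i^2)\to\mathbf I_{\mathbf x}\mathcal B(n,k,\mathcal S)\mathbf I_{\mathbf y}$$ be the map $p\otimes c\mapsto (p f_{\mathbf x,\mathbf y})\otimes c$. Write $\mathbf x=\{x_1<\dots<x_k\}$ and $\mathbf y=\{y_1<\dots<y_k\}$. The pair $\mathbf x,\mathbf y$ is *far* if $|x_a-y_a|>1$ for some $a$. If $\mathbf x,\mathbf y$ are not far, a *generating interval* for them is an interval $G=[j+1,j+l]$ with $0\le j<j+l\le n$ such that $j,j+l\notin\mathbf x\cap\mathbf y$, such that $t\in\mathbf x\cap\mathbf y$ for all $j<t<j+l$, and such that $v_i(\mathbf x,\mathbf y)=0$ for all $i\in[j+1,j+l]$; put $p_G=U_{j+1}\cdots U_{j+l}$. **Theorem.** Let $\mathbf x,\mathbf y\in V(n,k)$. (1) Suppose that $\mathbf x,\mathbf y$ are not far. Let $G_1,\dots,G_b$ be the generating intervals for $\mathbf x$ and $\mathbf y$, put $p_a=p_{G_a}$, and for each $a$ with $G_a\cap\mathcal S\neq\varnothing$ let $i_a$ be any element of $G_a\cap\mathcal S$. Then the elements $$\phi\left(p\prod_{a=1}^b\Big(\frac{C_{i_a}p_a}{U_{i_a}}\Big)^{\varepsilon_a}\right)$$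 are cycles, and their homology classes form a basis over $\mathbb F_2$ of $\mathbf I_{\mathbf x}H_*(\mathcal B(n,k,\mathcal S))\mathbf I_{\mathbf y}$ (distinct indices giving distinct basis elements). Here $p$ ranges over the monomials in the variables $U_i$, $i\notin\mathcal S$, that are not divisible by $p_G$ for any generating interval $G$, and $\varepsilon_a$ ranges over $\{0,1\}$ if $G_a\cap\mathcal S\neq\varnothing$ and is $0$ if $G_a\cap\mathcal S=\varnothing$. (2) If $\mathbf x,\mathbf y$ are far, then $\mathbf I_{\mathbf x}H_*(\mathcal B(n,k,\mathcal S))\mathbf I_{\mathbf y}=0$. -/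

import Mathlib

open scoped TensorProduct

noncomputable section

namespace OSz

/-! ### I-states, weight vectors

The coordinates (regions) `0, 1, …, n` are the elements of `Fin (n + 1)`. The lines `1, …, n` are
indexed by `Fin n`: the element `t : Fin n` stands for the line number `i = t + 1`, which lies
between the coordinates `i - 1 = t.castSucc` and `i = t.succ`. -/

/-- The set `V(n, k)` of I-states: the `k`-element subsets of `[0, n]`. -/
abbrev IState (n k : ℕ) : Type := {x : Finset (Fin (n + 1)) // x.card = k}

/-- The ring `𝔽₂[U₁, …, Uₙ]`. -/
abbrev PolyU (n : ℕ) : Type := MvPolynomial (Fin n) (ZMod 2)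

variable {n k : ℕ}

/-- The minimal relative weight vector, `v_i(x, y) = |y ∩ [i, n]| - |x ∩ [i, n]|`. -/
def weight (x y : IState n k) (t : Fin n) : ℤ :=
  ((y.1.filter (fun c => t.succ ≤ c)).card : ℤ) - ((x.1.filter (fun c => t.succ ≤ c)).card : ℤ)

theorem weight_add (x y z : IState n k) (t : Fin n) :
    weight x z t = weight x y t + weight y z t := by
  unfold weight; ring

theorem weight_self (x : IState n k) (t : Fin n) : weight x x t = 0 := by
  unfold weight; ring

/-- The exponent of `U_i` in `f_{x,y} f_{y,z}`:
`(|v|_i(y,z) - |v|_i(x,z) + |v|_i(x,y)) / 2`. The numerator is a nonnegative even integer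
(see `two_mul_mulExp`), so nothing is lost in computing with natural numbers. -/
def mulExp (x y z : IState n k) (t : Fin n) : ℕ :=
  ((weight x y t).natAbs + (weight y z t).natAbs - (weight x z t).natAbs) / 2

theorem two_mul_mulExp (x y z : IState n k) (t : Fin n) :
    2 * (mulExp x y z t : ℤ) = |weight y z t| - |weight x z t| + |weight x y t| := by
  have h := weight_add x y z t
  unfold mulExp
  rw [← Int.natCast_natAbs, ← Int.natCast_natAbs, ← Int.natCast_natAbs]
  omega

theorem mulExp_assoc (x y z w : IState n k) (t : Fin n) :
    mulExp x y z t + mulExp x z w t = mulExp y z w t + mulExp x y w t := by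
  have h1 := two_mul_mulExp x y z t
  have h2 := two_mul_mulExp x z w t
  have h3 := two_mul_mulExp y z w t
  have h4 := two_mul_mulExp x y w t
  omega

theorem mulExp_left (x z : IState n k) (t : Fin n) : mulExp x x z t = 0 := by
  have := two_mul_mulExp x x z t
  simp only [weight_self, abs_zero] at this
  omega

theorem mulExp_right (x z : IState n k) (t : Fin n) : mulExp x z z t = 0 := by
  have := two_mul_mulExp x z z t
  simp only [weight_self, abs_zero] at this
  omega

/-- The monomial `∏ U_i ^ ((|v|_i(y,z) - |v|_i(x,z) + |v|_i(x,y)) / 2)`. -/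
def mulCoeff (x y z : IState n k) : PolyU n := ∏ t : Fin n, MvPolynomial.X t ^ mulExp x y z t

theorem mulCoeff_assoc (x y z w : IState n k) :
    mulCoeff x y z * mulCoeff x z w = mulCoeff y z w * mulCoeff x y w := by
  simp only [mulCoeff, ← Finset.prod_mul_distrib, ← pow_add]
  exact Finset.prod_congr rfl fun t _ => by rw [mulExp_assoc]

@[simp] theorem mulCoeff_left (x z : IState n k) : mulCoeff x x z = 1 := by
  simp [mulCoeff, mulExp_left]

@[simp] theorem mulCoeff_right (x z : IState n k) : mulCoeff x z z = 1 := by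
  simp [mulCoeff, mulExp_right]

/-! ### The algebra `B₀(n, k)` -/

/-- The algebra `B₀(n, k)`: the free `𝔽₂[U₁, …, Uₙ]`-module on generators `f_{x,y}`, for I-states
`x` and `y`. The element `a` is `∑ a x y • f_{x,y}`, and the product is determined by
`f_{x,y} f_{y,z} = ∏ U_i ^ ((|v|_i(y,z) - |v|_i(x,z) + |v|_i(x,y)) / 2) f_{x,z}` and
`f_{x,y} f_{z,w} = 0` for `y ≠ z` (see `f_mul_f`, `f_mul_f_of_ne`, `one_eq`). -/
def B0 (n k : ℕ) : Type := IState n k → IState n k → PolyU n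

namespace B0

instance : AddCommGroup (B0 n k) := inferInstanceAs (AddCommGroup (IState n k → IState n k → PolyU n))

instance : Module (PolyU n) (B0 n k) :=
  inferInstanceAs (Module (PolyU n) (IState n k → IState n k → PolyU n))

instance : Module (ZMod 2) (B0 n k) :=
  inferInstanceAs (Module (ZMod 2) (IState n k → IState n k → PolyU n))

instance : IsScalarTower (ZMod 2) (PolyU n) (B0 n k) :=
  inferInstanceAs (IsScalarTower (ZMod 2) (PolyU n) (IState n k → IState n k → PolyU n))

instance : Mul (B0 n k) := ⟨fun a b x z => ∑ y, mulCoeff x y z * (a x y * b y z)⟩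

instance : One (B0 n k) := ⟨fun x y => if x = y then 1 else 0⟩

@[ext] theorem ext {a b : B0 n k} (h : ∀ x y, a x y = b x y) : a = b :=
  funext fun x => funext fun y => h x y

theorem mul_apply (a b : B0 n k) (x z : IState n k) :
    (a * b) x z = ∑ y, mulCoeff x y z * (a x y * b y z) := rfl

theorem one_apply (x y : IState n k) : (1 : B0 n k) x y = if x = y then 1 else 0 := rfl

@[simp] theorem add_apply (a b : B0 n k) (x y : IState n k) : (a + b) x y = a x y + b x y := rfl

@[simp] theorem zero_apply (x y : IState n k) : (0 : B0 n k) x y = 0 := rfl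

@[simp] theorem smul_apply (p : PolyU n) (a : B0 n k) (x y : IState n k) :
    (p • a) x y = p * a x y := rfl

protected theorem mul_assoc (a b c : B0 n k) : a * b * c = a * (b * c) := by
  ext1 x w
  simp only [mul_apply, Finset.mul_sum, Finset.sum_mul]
  rw [Finset.sum_comm]
  refine Finset.sum_congr rfl fun y _ => Finset.sum_congr rfl fun z _ => ?_
  linear_combination (a x y * b y z * c z w) * mulCoeff_assoc x y z w

instance : Ring (B0 n k) :=
  { (inferInstance : AddCommGroup (B0 n k)) with
    mul := (· * ·)
    one := 1
    mul_assoc := B0.mul_assoc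
    one_mul := fun a => by
      ext1 x y
      simp [mul_apply, one_apply]
    mul_one := fun a => by
      ext1 x y
      simp [mul_apply, one_apply]
    zero_mul := fun a => by
      ext1 x y
      simp [mul_apply]
    mul_zero := fun a => by
      ext1 x y
      simp [mul_apply]
    left_distrib := fun a b c => by
      ext1 x y
      simp [mul_apply, mul_add, Finset.sum_add_distrib]
    right_distrib := fun a b c => by
      ext1 x y
      simp [mul_apply, add_mul, mul_add, Finset.sum_add_distrib] }

instance : Algebra (PolyU n) (B0 n k) :=
  Algebra.ofModule
    (fun p a b => by
      ext1 x y
      simp only [mul_apply, smul_apply, Finset.mul_sum]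
      exact Finset.sum_congr rfl fun _ _ => by ring)
    (fun p a b => by
      ext1 x y
      simp only [mul_apply, smul_apply, Finset.mul_sum]
      exact Finset.sum_congr rfl fun _ _ => by ring)

instance : Algebra (ZMod 2) (B0 n k) :=
  Algebra.ofModule
    (fun r a b => by
      rw [← algebraMap_smul (PolyU n) r a, ← algebraMap_smul (PolyU n) r (a * b),
        smul_mul_assoc])
    (fun r a b => by
      rw [← algebraMap_smul (PolyU n) r b, ← algebraMap_smul (PolyU n) r (a * b),
        mul_smul_comm])

/-- The generator `f_{x,y}` of `B₀(n, k)`. -/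
def f (x y : IState n k) : B0 n k := fun x' y' => if x' = x ∧ y' = y then 1 else 0

theorem f_mul_f (x y z : IState n k) : f x y * f y z = mulCoeff x y z • f x z := by
  ext1 a b
  rw [mul_apply, Finset.sum_eq_single y]
  · by_cases h1 : a = x <;> by_cases h2 : b = z <;> simp [f, h1, h2]
  · intro c _ hc
    simp [f, hc]
  · simp

theorem f_mul_f_of_ne (x z : IState n k) {y y' : IState n k} (h : y ≠ y') :
    f x y * f y' z = 0 := by
  ext1 a b
  rw [mul_apply]
  refine Finset.sum_eq_zero fun c _ => ?_
  by_cases h1 : c = y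
  · simp [f, h1, h]
  · simp [f, h1]

theorem sum_apply {ι : Type} (s : Finset ι) (g : ι → B0 n k) (x y : IState n k) :
    (∑ i ∈ s, g i) x y = ∑ i ∈ s, g i x y := by
  classical
  induction s using Finset.induction_on with
  | empty => simp
  | insert a s ha ih => rw [Finset.sum_insert ha, Finset.sum_insert ha, add_apply, ih]

theorem one_eq : (1 : B0 n k) = ∑ x, f x x := by
  ext1 a b
  rw [sum_apply, one_apply, Finset.sum_eq_single a]
  · simp [f, eq_comm]
  · intro c _ hc
    simp [f, hc.symm]
  · simp

theorem eq_sum (a : B0 n k) : a = ∑ x, ∑ y, a x y • f x y := by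
  ext1 x y
  rw [sum_apply, Finset.sum_eq_single x, sum_apply, Finset.sum_eq_single y]
  · simp [f]
  · intro c _ hc
    simp [f, hc.symm]
  · simp
  · intro c _ hc
    rw [sum_apply]
    exact Finset.sum_eq_zero fun d _ => by simp [f, hc.symm]
  · simp

/-- `B₀(n, k)` is the `𝔽₂[U₁, …, Uₙ]`-algebra presented by generators `f_{x,y}` and the relations
above: it is the path algebra of the complete directed graph on the set of I-states, with
`f_{x,x}` the idempotent `I_x` at the vertex `x`, modulo these relations. -/
theorem existsUnique_lift {A : Type*} [Ring A] [Algebra (PolyU n) A]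
    (g : IState n k → IState n k → A)
    (h₁ : ∀ x y z, g x y * g y z = mulCoeff x y z • g x z)
    (h₂ : ∀ x y y' z, y ≠ y' → g x y * g y' z = 0) (h₃ : ∑ x, g x x = 1) :
    ∃! F : B0 n k →ₐ[PolyU n] A, ∀ x y, F (f x y) = g x y := by
  have hf : ∀ x y, ∑ x', ∑ y', (f x y : B0 n k) x' y' • g x' y' = g x y := fun x y => by
    rw [Finset.sum_eq_single x, Finset.sum_eq_single y]
    · simp [f]
    · intro b _ hb; simp [f, hb]
    · simp
    · intro b _ hb; exact Finset.sum_eq_zero fun c _ => by simp [f, hb]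
    · simp
  let F : B0 n k →ₗ[PolyU n] A :=
    { toFun := fun a => ∑ x, ∑ y, a x y • g x y
      map_add' := fun a b => by simp [add_smul, Finset.sum_add_distrib]
      map_smul' := fun p a => by simp [mul_smul, Finset.smul_sum] }
  have hF : ∀ x y, F (f x y) = g x y := hf
  have hone : F 1 = 1 := by
    rw [one_eq, map_sum, ← h₃]
    exact Finset.sum_congr rfl fun x _ => hF x x
  have hmul : ∀ a b, F (a * b) = F a * F b := fun a b => by
    rw [eq_sum a, eq_sum b]
    simp only [Finset.sum_mul, Finset.mul_sum, map_sum]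
    refine Finset.sum_congr rfl fun x _ => Finset.sum_congr rfl fun y _ =>
      Finset.sum_congr rfl fun z _ => Finset.sum_congr rfl fun w _ => ?_
    rw [smul_mul_smul_comm, map_smul, map_smul, map_smul, smul_mul_smul_comm, hF, hF]
    congr 1
    rcases eq_or_ne w x with rfl | h
    · rw [f_mul_f, h₁, map_smul, hF]
    · rw [f_mul_f_of_ne _ _ h, h₂ _ _ _ _ h, map_zero]
  refine ⟨AlgHom.ofLinearMap F hone hmul, hF, fun G hG => ?_⟩
  refine AlgHom.ext fun a => ?_
  rw [eq_sum a]
  simp only [map_sum, map_smul, hG]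
  exact Finset.sum_congr rfl fun x _ => Finset.sum_congr rfl fun y _ => by
    rw [AlgHom.ofLinearMap_apply, hF]

/-- The element `R_i = ∑ f_{x,y}`, the sum over all I-states `x` with `x ∩ {i-1, i} = {i-1}`,
where `y = (x \ {i-1}) ∪ {i}`. -/
def R (t : Fin n) : B0 n k :=
  ∑ q ∈ (Finset.univ : Finset (IState n k × IState n k)).filter (fun q =>
    t.castSucc ∈ q.1.1 ∧ t.succ ∉ q.1.1 ∧ q.2.1 = insert t.succ (q.1.1.erase t.castSucc)), f q.1 q.2

/-- The element `L_i = ∑ f_{x,y}`, the sum over all I-states `x` with `x ∩ {i-1, i} = {i}`,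
where `y = (x \ {i}) ∪ {i-1}`. -/
def L (t : Fin n) : B0 n k :=
  ∑ q ∈ (Finset.univ : Finset (IState n k × IState n k)).filter (fun q =>
    t.succ ∈ q.1.1 ∧ t.castSucc ∉ q.1.1 ∧ q.2.1 = insert t.castSucc (q.1.1.erase t.succ)), f q.1 q.2

/-- The element `U_i = ∑ U_i f_{x,x}`. -/
def U (t : Fin n) : B0 n k := ∑ x : IState n k, (MvPolynomial.X t : PolyU n) • f x x

theorem U_eq_algebraMap (t : Fin n) :
    (U t : B0 n k) = algebraMap (PolyU n) (B0 n k) (MvPolynomial.X t) := by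
  rw [U, ← Finset.smul_sum, ← one_eq, Algebra.algebraMap_eq_smul_one]

end B0

/-! ### The algebra `B(n, k)` -/

/-- The elements of `B₀(n, k)` that are set to zero in `B(n, k)`: `R_i R_{i+1}` and `L_{i+1} L_i`,
and `I_x U_i` for `x ∩ {i-1, i} = ∅`; here `I_x = f_{x,x}`. -/
inductive Relator : B0 n k → Prop
  | RR (s t : Fin n) (h : (t : ℕ) = s + 1) : Relator (B0.R s * B0.R t)
  | LL (s t : Fin n) (h : (t : ℕ) = s + 1) : Relator (B0.L t * B0.L s)
  | IU (x : IState n k) (t : Fin n) (h₁ : t.castSucc ∉ x.1) (h₂ : t.succ ∉ x.1) :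
      Relator (B0.f x x * B0.U t)

/-- The two-sided ideal of `B₀(n, k)` generated by these elements. -/
def relIdeal (n k : ℕ) : Ideal (B0 n k) :=
  (TwoSidedIdeal.span {a : B0 n k | Relator a}).asIdeal

instance : (relIdeal n k).IsTwoSided :=
  inferInstanceAs (TwoSidedIdeal.span {a : B0 n k | Relator a}).asIdeal.IsTwoSided

/-- The algebra `B(n, k)`, the quotient of `B₀(n, k)` by this ideal. -/
def B (n k : ℕ) : Type := B0 n k ⧸ relIdeal n k

instance : Ring (B n k) := inferInstanceAs (Ring (B0 n k ⧸ relIdeal n k))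

instance : Algebra (PolyU n) (B n k) := inferInstanceAs (Algebra (PolyU n) (B0 n k ⧸ relIdeal n k))

instance : Algebra (ZMod 2) (B n k) := inferInstanceAs (Algebra (ZMod 2) (B0 n k ⧸ relIdeal n k))

/-- The quotient map `B₀(n, k) → B(n, k)`. -/
def toB (n k : ℕ) : B0 n k →ₐ[ZMod 2] B n k := Ideal.Quotient.mkₐ (ZMod 2) (relIdeal n k)

theorem toB_surjective : Function.Surjective (toB n k) := Ideal.Quotient.mk_surjective

theorem toB_eq_zero_iff (a : B0 n k) : toB n k a = 0 ↔ a ∈ relIdeal n k :=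
  Ideal.Quotient.eq_zero_iff_mem

/-- The element `U_i` of `B(n, k)`. -/
def U (t : Fin n) : B n k := toB n k (B0.U t)

theorem U_mul_comm (t : Fin n) (b : B n k) : U t * b = b * U t := by
  obtain ⟨a, rfl⟩ := toB_surjective b
  rw [U, ← map_mul, ← map_mul, B0.U_eq_algebraMap, Algebra.commutes]

/-! ### The differential algebra `B(n, k, S)` -/

variable {S : Finset (Fin n)}

variable (S) in
/-- The ideal of `𝔽₂[C_i | i ∈ S]` generated by the squares `C_i²`. -/
def sqIdeal : Ideal (MvPolynomial S (ZMod 2)) :=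
  Ideal.span (Set.range fun i : S => MvPolynomial.X i ^ 2)

variable (S) in
/-- The exterior algebra over `𝔽₂` in the variables `C_i`, `i ∈ S`, that is,
`𝔽₂[C_i | i ∈ S] / (C_i² = 0)`. -/
def Ext : Type := MvPolynomial S (ZMod 2) ⧸ sqIdeal S

instance : CommRing (Ext S) := inferInstanceAs (CommRing (MvPolynomial S (ZMod 2) ⧸ sqIdeal S))

instance : Algebra (ZMod 2) (Ext S) :=
  inferInstanceAs (Algebra (ZMod 2) (MvPolynomial S (ZMod 2) ⧸ sqIdeal S))

variable (S) in
/-- The quotient map `𝔽₂[C_i | i ∈ S] → 𝔽₂[C_i | i ∈ S] / (C_i² = 0)`. -/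
def toExt : MvPolynomial S (ZMod 2) →ₐ[ZMod 2] Ext S := Ideal.Quotient.mkₐ (ZMod 2) (sqIdeal S)

theorem toExt_surjective : Function.Surjective (toExt S) := Ideal.Quotient.mk_surjective

theorem toExt_eq_zero_iff (p : MvPolynomial S (ZMod 2)) : toExt S p = 0 ↔ p ∈ sqIdeal S :=
  Ideal.Quotient.eq_zero_iff_mem

/-- The variable `C_i`. -/
def C (i : S) : Ext S := toExt S (MvPolynomial.X i)

theorem pderiv_mem (i : S) (p : MvPolynomial S (ZMod 2)) (hp : p ∈ sqIdeal S) :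
    MvPolynomial.pderiv i p ∈ sqIdeal S := by
  induction hp using Submodule.span_induction with
  | mem x hx =>
    obtain ⟨j, rfl⟩ := hx
    have h2 : (2 : MvPolynomial S (ZMod 2)) = 0 := CharTwo.two_eq_zero
    simp [pow_two, Derivation.leibniz, ← two_mul, h2]
  | zero => simp
  | add x y _ _ hx hy => rw [map_add]; exact Ideal.add_mem _ hx hy
  | smul a x hx hx' =>
    rw [smul_eq_mul, Derivation.leibniz]
    exact Ideal.add_mem _ (Ideal.mul_mem_left _ _ hx')
      (by rw [smul_eq_mul]; exact Ideal.mul_mem_right _ _ hx)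

/-- The derivation `∂/∂C_i` of the exterior algebra: `C_i ↦ 1` and `C_j ↦ 0` for `j ≠ i`. -/
def dC (i : S) : Derivation (ZMod 2) (Ext S) (Ext S) :=
  Derivation.liftOfSurjective (f := toExt S) toExt_surjective (d := MvPolynomial.pderiv i)
    (fun p hp => (toExt_eq_zero_iff _).2 (pderiv_mem i p ((toExt_eq_zero_iff p).1 hp)))

theorem dC_toExt (i : S) (p : MvPolynomial S (ZMod 2)) :
    dC i (toExt S p) = toExt S (MvPolynomial.pderiv i p) :=
  Derivation.liftOfSurjective_apply toExt_surjective
    (fun p hp => (toExt_eq_zero_iff _).2 (pderiv_mem i p ((toExt_eq_zero_iff p).1 hp))) p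

theorem dC_C (i j : S) : dC i (C j) = if i = j then 1 else 0 := by
  rw [C, dC_toExt, MvPolynomial.pderiv_X, Pi.single_apply]
  by_cases h : i = j
  · simp [h]
  · simp [h, Ne.symm h]

variable (k S) in
/-- The algebra `B(n, k, S)`: the tensor product of `B(n, k)` with the exterior algebra in the
variables `C_i`, `i ∈ S`. -/
abbrev BS : Type := B n k ⊗[ZMod 2] Ext S

variable (k S) in
/-- The differential of `B(n, k, S)`: the `𝔽₂`-linear derivation with `∂(b) = 0` for `b ∈ B(n, k)`
and `∂(C_i) = U_i` (see `d_mul`, `d_B`, `d_C`, `d_d`). -/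
def d : BS k S →ₗ[ZMod 2] BS k S :=
  ∑ i : S, TensorProduct.map (LinearMap.mulLeft (ZMod 2) (U (i : Fin n) : B n k))
    (dC i : Ext S →ₗ[ZMod 2] Ext S)

theorem d_tmul (b : B n k) (c : Ext S) :
    d k S (b ⊗ₜ c) = ∑ i : S, (U (i : Fin n) * b) ⊗ₜ[ZMod 2] dC i c := by
  simp [d, LinearMap.sum_apply]

theorem d_B (b : B n k) : d k S (b ⊗ₜ 1) = 0 := by
  simp [d_tmul]

theorem d_C (i : S) : d k S (1 ⊗ₜ C i) = U (i : Fin n) ⊗ₜ 1 := by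
  rw [d_tmul, Finset.sum_eq_single i]
  · simp [dC_C]
  · intro j _ hj
    simp [dC_C, hj]
  · simp

theorem d_mul (a b : BS k S) : d k S (a * b) = d k S a * b + a * d k S b := by
  induction a using TensorProduct.induction_on with
  | zero => simp
  | add a₁ a₂ h₁ h₂ => rw [add_mul, map_add, h₁, h₂, map_add, add_mul, add_mul]; abel
  | tmul a c =>
    induction b using TensorProduct.induction_on with
    | zero => simp
    | add b₁ b₂ h₁ h₂ => rw [mul_add, map_add, h₁, h₂, map_add, mul_add, mul_add]; abel
    | tmul b e =>
      rw [Algebra.TensorProduct.tmul_mul_tmul]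
      simp only [d_tmul, Finset.sum_mul, Finset.mul_sum, Algebra.TensorProduct.tmul_mul_tmul]
      rw [← Finset.sum_add_distrib]
      refine Finset.sum_congr rfl fun i _ => ?_
      rw [Derivation.leibniz, TensorProduct.tmul_add, smul_eq_mul, smul_eq_mul, add_comm,
        mul_comm e, ← mul_assoc, ← mul_assoc, U_mul_comm _ a]

theorem add_self_BS (a : BS k S) : a + a = 0 := by
  rw [← two_smul (ZMod 2) a, show (2 : ZMod 2) = 0 from rfl, zero_smul]

theorem d_d (a : BS k S) : d k S (d k S a) = 0 := by
  induction a using TensorProduct.induction_on with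
  | zero => rw [map_zero, map_zero]
  | add a b ha hb => rw [map_add, map_add, ha, hb, add_zero]
  | tmul b c =>
    obtain ⟨p, rfl⟩ := toExt_surjective c
    induction p using MvPolynomial.induction_on generalizing b with
    | C r =>
      have h : toExt S (MvPolynomial.C r) = algebraMap (ZMod 2) (Ext S) r :=
        (toExt S).commutes r
      simp [h, d_tmul]
    | add p q hp hq => rw [map_add, TensorProduct.tmul_add, map_add, map_add, hp, hq, add_zero]
    | mul_X p i hp =>
      have h : b ⊗ₜ[ZMod 2] toExt S (p * MvPolynomial.X i) =
          (b ⊗ₜ toExt S p) * ((1 : B n k) ⊗ₜ C i) := by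
        rw [Algebra.TensorProduct.tmul_mul_tmul, mul_one, map_mul, C]
      rw [h, d_mul, map_add, d_mul, d_mul, hp, d_C, d_B, zero_mul, mul_zero, zero_add, add_zero,
        add_self_BS]

/-! ### Homology -/

theorem d_algebraMap (r : ZMod 2) : d k S (algebraMap (ZMod 2) (BS k S) r) = 0 :=
  d_B (algebraMap (ZMod 2) (B n k) r)

variable (k S) in
/-- The subalgebra `ker ∂` of `B(n, k, S)`. -/
def cycles : Subalgebra (ZMod 2) (BS k S) where
  carrier := {a | d k S a = 0}
  mul_mem' := fun {a b} ha hb => by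
    simp only [Set.mem_ofPred_eq] at ha hb ⊢
    rw [d_mul, ha, hb, zero_mul, mul_zero, add_zero]
  add_mem' := fun {a b} ha hb => by
    simp only [Set.mem_ofPred_eq] at ha hb ⊢
    rw [map_add, ha, hb, add_zero]
  algebraMap_mem' := d_algebraMap

theorem mem_cycles {a : BS k S} : a ∈ cycles k S ↔ d k S a = 0 := Iff.rfl

variable (k S) in
/-- The two-sided ideal of boundaries in `ker ∂`. -/
def boundaries : Ideal (cycles k S) where
  carrier := {z | ∃ a : BS k S, d k S a = z}
  add_mem' := by
    rintro y z ⟨a, ha⟩ ⟨b, hb⟩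
    exact ⟨a + b, by simp [ha, hb]⟩
  zero_mem' := ⟨0, by simp⟩
  smul_mem' := by
    rintro c z ⟨a, ha⟩
    refine ⟨c * a, ?_⟩
    rw [d_mul, mem_cycles.1 c.2, ha]
    simp

instance : (boundaries k S).IsTwoSided where
  mul_mem_of_left := by
    rintro z c ⟨a, ha⟩
    refine ⟨a * c, ?_⟩
    rw [d_mul, mem_cycles.1 c.2, ha]
    simp

variable (k S) in
/-- The homology algebra `H_*(B(n, k, S)) = ker ∂ / im ∂`. -/
abbrev Homology : Type := cycles k S ⧸ boundaries k S

variable (S) in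
/-- The idempotent `I_x` of `B(n, k, S)`, as a cycle. -/
def idem (x : IState n k) : cycles k S :=
  ⟨toB n k (B0.f x x) ⊗ₜ 1, mem_cycles.2 (d_B _)⟩

variable (S) in
/-- The class `[I_x]` in the homology algebra. -/
def idemClass (x : IState n k) : Homology k S := Ideal.Quotient.mk (boundaries k S) (idem S x)

variable (S) in
/-- The summand `I_x H_*(B(n, k, S)) I_y`. -/
def homologySummand (x y : IState n k) : Submodule (ZMod 2) (Homology k S) :=
  LinearMap.range (LinearMap.mulLeft (ZMod 2) (idemClass S x) ∘ₗ
    LinearMap.mulRight (ZMod 2) (idemClass S y))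

/-! ### Far pairs, generating intervals, and the proposed basis -/

/-- `x` and `y` are far if `|x_a - y_a| > 1` for some `a`, where `x_1 < ⋯ < x_k` are the elements
of `x` and `y_1 < ⋯ < y_k` those of `y`. -/
def Far (x y : IState n k) : Prop :=
  ∃ a : Fin k, 1 < |((x.1.orderEmbOfFin x.2 a : ℕ) : ℤ) - ((y.1.orderEmbOfFin y.2 a : ℕ) : ℤ)|

/-- The set of lines in `[j + 1, m]`. -/
def lines (j m : Fin (n + 1)) : Finset (Fin n) :=
  Finset.univ.filter fun t => j < t.succ ∧ t.succ ≤ m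

/-- A generating interval `[j + 1, m]`, `m = j + l`, for `x` and `y` (which are assumed not to be
far wherever this is used): the coordinates `j` and `m` are not fully used, each coordinate
strictly between them is fully used (belongs to `x ∩ y`), and no line in `[j + 1, m]` is crossed. -/
@[ext] structure GenInterval (x y : IState n k) where
  j : Fin (n + 1)
  m : Fin (n + 1)
  lt : j < m
  left_not_used : j ∉ x.1 ∩ y.1
  right_not_used : m ∉ x.1 ∩ y.1
  used : ∀ t, j < t → t < m → t ∈ x.1 ∩ y.1
  not_crossed : ∀ t ∈ lines j m, weight x y t = 0

variable {x y : IState n k}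

instance : Finite (GenInterval x y) :=
  Finite.of_injective (fun G => (G.j, G.m)) fun G G' h => by
    rw [Prod.mk.injEq] at h
    exact GenInterval.ext h.1 h.2

instance : Fintype (GenInterval x y) := Fintype.ofFinite _

/-- The lines in a generating interval. -/
def GenInterval.lines (G : GenInterval x y) : Finset (Fin n) := OSz.lines G.j G.m

/-- The monomial `p_G = U_{j+1} ⋯ U_{j+l}`. -/
def GenInterval.p (G : GenInterval x y) : PolyU n := ∏ t ∈ G.lines, MvPolynomial.X t

variable (S x y) in
/-- The generating intervals that meet `S`. -/
abbrev MeetingInterval : Type := {G : GenInterval x y // (G.lines ∩ S).Nonempty}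

instance : Fintype (MeetingInterval S x y) := Fintype.ofFinite _

variable (S x y) in
/-- The index set of the basis: an exponent vector `e` of a monomial `p` in the variables `U_i`,
`i ∉ S`, that is not divisible by `p_G` for any generating interval `G`, and a number
`ε_G ∈ {0, 1}` for each generating interval `G` that meets `S`. -/
structure BasisIndex where
  e : Fin n →₀ ℕ
  e_eq_zero : ∀ t ∈ S, e t = 0
  not_dvd : ∀ G : GenInterval x y, ¬ G.p ∣ MvPolynomial.monomial e (1 : ZMod 2)
  ε : MeetingInterval S x y → Fin 2

variable (S x y) in
/-- The map `φ : 𝔽₂[U₁, …, Uₙ] → I_x B(n, k) I_y`, `p ↦ p f_{x,y}`, extended to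
`𝔽₂[U₁, …, Uₙ][C_i | i ∈ S] / (C_i²)` by the identity on the variables `C_i`. -/
def φ : PolyU n ⊗[ZMod 2] Ext S →ₗ[ZMod 2] BS k S :=
  TensorProduct.map
    ((toB n k).toLinearMap ∘ₗ
      (LinearMap.toSpanSingleton (PolyU n) (B0 n k) (B0.f x y)).restrictScalars (ZMod 2))
    LinearMap.id

/-- The element `C_i p_G / U_i`, for `i ∈ S`. -/
def GenInterval.factor (G : GenInterval x y) (i : S) : PolyU n ⊗[ZMod 2] Ext S :=
  (∏ t ∈ G.lines.erase i, MvPolynomial.X t) ⊗ₜ C i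

/-- The element `φ(p ∏_G (C_{i_G} p_G / U_{i_G}) ^ ε_G)`; `i` is the choice of an element of
`G ∩ S` for each generating interval `G` that meets `S`. -/
def basisElt (i : MeetingInterval S x y → S) (q : BasisIndex S x y) : BS k S :=
  φ S x y ((MvPolynomial.monomial q.e (1 : ZMod 2)) ⊗ₜ 1 *
    ∏ G : MeetingInterval S x y, G.1.factor (i G) ^ (q.ε G : ℕ))

end OSz

end

/-!
Three steps compute `I_x H_*(B(n, k, S)) I_y`.

*The module `I_x B(n, k) I_y`.* It is zero if `x` and `y` are far, and otherwise it has as a basis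
the elements `U ^ e f_{x,y}` with `U ^ e` not divisible by any `p_G`. That the other elements vanish
follows by factoring `f_{x,y}` through suitable I-states: in the far case so that a factor
`R_i R_{i+1}` or `L_{i+1} L_i` appears (`Far.f_mem_relIdeal`), and for a generating interval `G`
through an I-state for which `p_G` reduces, by moving one coordinate at a time, to a relation
`I_z U_i = 0` (`GenInterval.p_smul_f_mem_relIdeal`). For the converse, choose `k` of the lines
`0, …, n + 1` and call an I-state compatible if its `a`-th coordinate is adjacent to the `a`-th
chosen line, for each `a`. The algebra `B₀(n, k)` acts on the sum, over the compatible I-states, of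
copies of `𝔽₂[U₁, …, Uₙ]` modulo the variables of the lines not chosen, and the relations act as
zero (`Track.relIdeal_apply_mem`). If no `p_G` divides `U ^ e`, a choice of lines exists for which
`x` and `y` are compatible and which includes all lines occurring in `U ^ e` (`exists_track`), so
that `U ^ e f_{x,y}` acts nontrivially.

*Generation by the cycles.* If `x` and `y` are not far, `I_x B(n, k, S) I_y` thus has an explicit
basis, and it is multigraded. In the multidegree `g` the basis is indexed by certain subsets `σ` of
`S`, and the differential of `σ` is the sum of the `σ \ {c}`, with `c ∈ σ`, that are among these
subsets (`coef_d`). Where the homotopy `C_c / U_c` makes sense, it replaces a cycle by a homologous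
one all of whose terms contain `C_c` and do not permit its removal (`exists_reduction_step`). Used
for all `c` in `S`, in suitable multidegrees, this leaves only the terms that are basis cycles
(`exists_reduction`, `exists_basisElt_eq_mon`).

*Independence.* The multidegrees of the proposed basis cycles are distinct. In such a multidegree,
`σ` runs through the sets of lines in the generating intervals `G` with `ε_G = 1` which meet each of
these intervals. The sum of the coefficients of the smallest such sets is a linear form that takes
the value `1` on the basis cycle and vanishes on boundaries: a set with one element more has exactly
two elements that can be removed (`dualForm_d`).
-/

noncomputable section

namespace OSz

section

variable {n k : ℕ}

/-! ### Counting functions of I-states -/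

/-- The counting function `i ↦ |x ∩ [i, n]|` of an I-state. It determines `x`, and all notions
concerning I-states are expressed through it; it is integer valued to allow subtraction. -/
def cnt (x : IState n k) (i : ℕ) : ℤ := ((x.1.filter (fun c => i ≤ c.val)).card : ℤ)

theorem weight_eq_cnt_sub (x y : IState n k) (t : Fin n) :
    weight x y t = cnt y (t + 1) - cnt x (t + 1) := by
  simp [weight, cnt, Fin.le_def]

theorem cnt_zero (x : IState n k) : cnt x 0 = k := by
  simp [cnt, x.2]

theorem cnt_eq_zero (x : IState n k) {i : ℕ} (hi : n + 1 ≤ i) : cnt x i = 0 := by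
  simp only [cnt, Nat.cast_eq_zero, Finset.card_eq_zero, Finset.filter_eq_empty_iff]
  intro c _
  have := c.2
  omega

theorem cnt_nonneg (x : IState n k) (i : ℕ) : 0 ≤ cnt x i := by simp [cnt]

theorem cnt_eq_add (x : IState n k) (c : Fin (n + 1)) :
    cnt x c = cnt x (c + 1) + if c ∈ x.1 then 1 else 0 := by
  have h : x.1.filter (fun a => c.val ≤ a.val) =
      x.1.filter (fun a => c.val + 1 ≤ a.val) ∪ x.1.filter (fun a => a = c) := by
    ext a
    simp only [Finset.mem_filter, Finset.mem_union, Fin.ext_iff, ← and_or_left]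
    exact and_congr_right fun _ => by omega
  unfold cnt
  rw [h, Finset.card_union_of_disjoint, Finset.filter_eq']
  · split_ifs <;> simp
  · rw [Finset.disjoint_left]
    intro a h h'
    have h1 := (Finset.mem_filter.1 h).2
    have h2 := congrArg Fin.val (Finset.mem_filter.1 h').2
    omega

theorem mem_iff_cnt (x : IState n k) (c : Fin (n + 1)) :
    c ∈ x.1 ↔ cnt x c = cnt x (c + 1) + 1 := by
  rw [cnt_eq_add x c]
  split_ifs with h <;> simp [h]

theorem notMem_iff_cnt (x : IState n k) (c : Fin (n + 1)) :
    c ∉ x.1 ↔ cnt x c = cnt x (c + 1) := by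
  rw [cnt_eq_add x c]
  split_ifs with h <;> simp [h]

theorem cnt_succ_le (x : IState n k) (i : ℕ) : cnt x (i + 1) ≤ cnt x i := by
  by_cases hi : i < n + 1
  · have := cnt_eq_add x ⟨i, hi⟩
    simp only at this
    split_ifs at this <;> omega
  · rw [cnt_eq_zero x (by omega : n + 1 ≤ i), cnt_eq_zero x (by omega : n + 1 ≤ i + 1)]

theorem cnt_le_succ_add_one (x : IState n k) (i : ℕ) : cnt x i ≤ cnt x (i + 1) + 1 := by
  by_cases hi : i < n + 1
  · have := cnt_eq_add x ⟨i, hi⟩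
    simp only at this
    split_ifs at this <;> omega
  · rw [cnt_eq_zero x (by omega : n + 1 ≤ i), cnt_eq_zero x (by omega : n + 1 ≤ i + 1)]
    norm_num

/-- Every function with the evident properties of a counting function comes from an I-state. -/
theorem exists_cnt_eq (ν : ℕ → ℤ) (h0 : ν 0 = k) (hlast : ν (n + 1) = 0)
    (h1 : ∀ i ≤ n, ν (i + 1) ≤ ν i) (h2 : ∀ i ≤ n, ν i ≤ ν (i + 1) + 1) :
    ∃ z : IState n k, ∀ i ≤ n + 1, cnt z i = ν i := by
  classical
  let s : Finset (Fin (n + 1)) := Finset.univ.filter fun c => ν c = ν (c + 1) + 1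
  have key : ∀ d i, i + d = n + 1 → ((s.filter (fun c => i ≤ c.val)).card : ℤ) = ν i := by
    intro d
    induction d with
    | zero =>
      intro i hi
      obtain rfl : i = n + 1 := by omega
      rw [hlast, Nat.cast_eq_zero, Finset.card_eq_zero, Finset.filter_eq_empty_iff]
      intro c _
      have := c.2
      omega
    | succ d ih =>
      intro i hi
      have hs := ih (i + 1) (by omega)
      have hu : s.filter (fun a => i ≤ a.val) =
          s.filter (fun a => i + 1 ≤ a.val) ∪ s.filter (fun a => a = ⟨i, by omega⟩) := by
        ext a
        simp only [Finset.mem_filter, Finset.mem_union, Fin.ext_iff, ← and_or_left]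
        exact and_congr_right fun _ => by omega
      rw [hu, Finset.card_union_of_disjoint, Finset.filter_eq']
      · have := h1 i (by omega)
        have := h2 i (by omega)
        have hmem : (⟨i, by omega⟩ : Fin (n + 1)) ∈ s ↔ ν i = ν (i + 1) + 1 := by simp [s]
        push_cast
        rw [hs]
        split_ifs with h
        · rw [hmem] at h
          simp [h]
        · rw [hmem] at h
          simp only [Finset.card_empty, Nat.cast_zero]
          omega
      · rw [Finset.disjoint_left]
        intro a h h'
        have h1 := (Finset.mem_filter.1 h).2
        have h2 : a.val = i := congrArg Fin.val (Finset.mem_filter.1 h').2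
        omega
  refine ⟨⟨s, ?_⟩, fun i hi => key (n + 1 - i) i (by omega)⟩
  have := key (n + 1) 0 (by omega)
  rw [h0] at this
  simpa using this

theorem le_orderEmbOfFin_iff (x : IState n k) (a : Fin k) (i : ℕ) :
    i ≤ (x.1.orderEmbOfFin x.2 a : ℕ) ↔ (k : ℤ) - a ≤ cnt x i := by
  classical
  set e := x.1.orderEmbOfFin x.2 with he
  have hcard : (x.1.filter (fun c => i ≤ c.val)).card =
      (Finset.univ.filter fun b : Fin k => i ≤ (e b : ℕ)).card := by
    have hx : x.1 = Finset.univ.map e.toEmbedding := (x.1.map_orderEmbOfFin_univ x.2).symm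
    rw [hx, Finset.filter_map, Finset.card_map]
    rfl
  have ha := a.2
  unfold cnt
  rw [hcard]
  constructor
  · intro h
    have hsub : Finset.Ici a ⊆ Finset.univ.filter fun b : Fin k => i ≤ (e b : ℕ) := by
      intro b hb
      have : e a ≤ e b := e.monotone (Finset.mem_Ici.1 hb)
      simp only [Finset.mem_filter, Finset.mem_univ, true_and]
      exact h.trans this
    have := Finset.card_le_card hsub
    rw [Fin.card_Ici] at this
    omega
  · intro h
    by_contra hlt
    have hsub : (Finset.univ.filter fun b : Fin k => i ≤ (e b : ℕ)) ⊆ Finset.Ioi a := by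
      intro b hb
      simp only [Finset.mem_filter, Finset.mem_univ, true_and] at hb
      rw [Finset.mem_Ioi]
      by_contra hba
      have : e b ≤ e a := e.monotone (not_lt.1 hba)
      exact hlt (hb.trans this)
    have := Finset.card_le_card hsub
    rw [Fin.card_Ioi] at this
    omega

theorem far_iff_cnt (x y : IState n k) :
    Far x y ↔ ∃ i, cnt x i < cnt y (i + 1) ∨ cnt y i < cnt x (i + 1) := by
  constructor
  · rintro ⟨a, ha⟩
    rcases lt_abs.1 ha with h | h
    · refine ⟨(y.1.orderEmbOfFin y.2 a : ℕ) + 1, Or.inr ?_⟩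
      have h1 := (le_orderEmbOfFin_iff x a ((y.1.orderEmbOfFin y.2 a : ℕ) + 1 + 1)).1 (by omega)
      have h2 := mt (le_orderEmbOfFin_iff y a ((y.1.orderEmbOfFin y.2 a : ℕ) + 1)).2 (by omega)
      omega
    · refine ⟨(x.1.orderEmbOfFin x.2 a : ℕ) + 1, Or.inl ?_⟩
      have h1 := (le_orderEmbOfFin_iff y a ((x.1.orderEmbOfFin x.2 a : ℕ) + 1 + 1)).1 (by omega)
      have h2 := mt (le_orderEmbOfFin_iff x a ((x.1.orderEmbOfFin x.2 a : ℕ) + 1)).2 (by omega)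
      omega
  · have key : ∀ (x y : IState n k) (i : ℕ), cnt x i < cnt y (i + 1) → ∃ a : Fin k,
        (x.1.orderEmbOfFin x.2 a : ℕ) + 1 < (y.1.orderEmbOfFin y.2 a : ℕ) := by
      intro x y i h
      have hk : cnt y (i + 1) ≤ k := by
        have := Finset.card_filter_le y.1 (fun c => i + 1 ≤ c.val)
        rw [y.2] at this
        unfold cnt
        omega
      have h0 := cnt_nonneg x i
      refine ⟨⟨k - (cnt y (i + 1)).toNat, by omega⟩, ?_⟩
      have h1 := (le_orderEmbOfFin_iff y ⟨k - (cnt y (i + 1)).toNat, by omega⟩ (i + 1)).2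
        (by push_cast; omega)
      have h2 := mt (le_orderEmbOfFin_iff x ⟨k - (cnt y (i + 1)).toNat, by omega⟩ i).1
        (by push_cast; omega)
      omega
    rintro ⟨i, h | h⟩
    · obtain ⟨a, ha⟩ := key x y i h
      exact ⟨a, lt_abs.2 (Or.inr (by omega))⟩
    · obtain ⟨a, ha⟩ := key y x i h
      exact ⟨a, lt_abs.2 (Or.inl (by omega))⟩

end

section

variable {n k : ℕ}

/-! ### Elements of the ideal of relations -/

theorem eq_of_cnt_eq {x y : IState n k} (h : ∀ i, cnt x i = cnt y i) : x = y := by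
  apply Subtype.ext
  ext c
  rw [mem_iff_cnt, mem_iff_cnt, h, h]

/-- `u` is obtained from `z` by moving the coordinate `t` to `t + 1`, that is, by crossing the
line `t` to the right. -/
def MovesRight (t : Fin n) (z u : IState n k) : Prop :=
  ∀ i, cnt u i = cnt z i + if i = t + 1 then 1 else 0

theorem MovesRight.mem_iff {t : Fin n} {z u : IState n k} (h : MovesRight t z u)
    (c : Fin (n + 1)) :
    c ∈ u.1 ↔ c = t.succ ∨ c ≠ t.castSucc ∧ c ∈ z.1 := by
  have h1 := h c
  have h2 := h (c + 1)
  have h3 := h t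
  have h4 := h (t + 1)
  have h5 := h (t + 1 + 1)
  have := cnt_succ_le u t
  have := cnt_le_succ_add_one u (t + 1)
  have := cnt_succ_le z (t + 1)
  have := cnt_le_succ_add_one z t
  have e1 : c = t.succ ↔ c.val = t.val + 1 := by rw [Fin.ext_iff]; simp
  have e2 : c = t.castSucc ↔ c.val = t.val := by rw [Fin.ext_iff]; simp
  rw [mem_iff_cnt, mem_iff_cnt, e1, Ne, e2]
  rcases lt_trichotomy c.val t.val with hc | hc | hc
  · simp only [show c.val ≠ t.val + 1 by omega, show c.val + 1 ≠ t.val + 1 by omega,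
      if_false] at h1 h2
    omega
  · rw [hc] at *
    simp at h2 h3 h5
    omega
  · by_cases hc' : c.val = t.val + 1
    · rw [hc'] at *
      simp at h1 h3 h5
      omega
    · simp only [hc', show c.val + 1 ≠ t.val + 1 by omega, if_false] at h1 h2
      omega

theorem movesRight_iff (t : Fin n) (z u : IState n k) :
    MovesRight t z u ↔
      t.castSucc ∈ z.1 ∧ t.succ ∉ z.1 ∧ u.1 = insert t.succ (z.1.erase t.castSucc) := by
  have back : ∀ u : IState n k, MovesRight t z u →
      u.1 = insert t.succ (z.1.erase t.castSucc) := by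
    intro u h
    ext c
    rw [h.mem_iff, Finset.mem_insert, Finset.mem_erase]
  constructor
  · intro h
    have h3 := h t
    have h4 := h (t + 1)
    have h5 := h (t + 1 + 1)
    have := cnt_succ_le u t
    have := cnt_le_succ_add_one u (t + 1)
    have := cnt_succ_le z (t + 1)
    have := cnt_le_succ_add_one z t
    simp at h3 h4 h5
    refine ⟨?_, ?_, back u h⟩
    · rw [mem_iff_cnt, Fin.val_castSucc]
      omega
    · rw [notMem_iff_cnt, Fin.val_succ]
      omega
  · rintro ⟨h1, h2, h3⟩
    rw [mem_iff_cnt, Fin.val_castSucc] at h1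
    rw [notMem_iff_cnt, Fin.val_succ] at h2
    have ht := t.2
    obtain ⟨u', hu'⟩ := exists_cnt_eq (k := k) (n := n)
      (fun i => cnt z i + if i = t + 1 then 1 else 0)
      (by simp [cnt_zero])
      (by simp [cnt_eq_zero]; omega)
      (fun i hi => by
        have := cnt_succ_le z i
        by_cases hi : i = t
        · subst hi; simp; omega
        · simp only [add_left_inj, hi, if_false]
          split_ifs <;> omega)
      (fun i hi => by
        have := cnt_le_succ_add_one z i
        by_cases hi : i = t + 1
        · subst hi; simp; omega
        · simp only [hi, if_false]
          split_ifs <;> omega)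
    have hm : MovesRight t z u' := by
      intro i
      by_cases hi : i ≤ n + 1
      · exact hu' i hi
      · rw [cnt_eq_zero _ (by omega), cnt_eq_zero _ (by omega), if_neg (by omega), add_zero]
    have : u = u' := Subtype.ext (h3.trans (back u' hm).symm)
    rwa [this]

theorem movesRight_iff_left (t : Fin n) (z u : IState n k) :
    MovesRight t u z ↔
      t.succ ∈ z.1 ∧ t.castSucc ∉ z.1 ∧ u.1 = insert t.castSucc (z.1.erase t.succ) := by
  have hne : t.castSucc ≠ t.succ := (Fin.castSucc_lt_succ).ne
  rw [movesRight_iff]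
  constructor
  · rintro ⟨h1, h2, h3⟩
    rw [h3]
    refine ⟨by simp, by simp [hne], ?_⟩
    rw [Finset.erase_insert (by simp [h2]), Finset.insert_erase h1]
  · rintro ⟨h1, h2, h3⟩
    rw [h3]
    refine ⟨by simp, by simp [hne.symm], ?_⟩
    rw [Finset.erase_insert (by simp [h2]), Finset.insert_erase h1]

namespace B0

open Classical in
theorem R_apply (t : Fin n) (z u : IState n k) :
    (R t : B0 n k) z u = if MovesRight t z u then 1 else 0 := by
  rw [R, sum_apply]
  simp only [f, ← movesRight_iff]
  rw [← Finset.sum_filter, Finset.filter_filter, Finset.sum_const]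
  split_ifs with h
  · rw [Finset.card_eq_one.2 ⟨(z, u), _⟩, one_smul]
    ext q
    simp only [Finset.mem_filter, Finset.mem_univ, true_and, Finset.mem_singleton, Prod.ext_iff]
    constructor
    · rintro ⟨-, h1, h2⟩
      exact ⟨h1.symm, h2.symm⟩
    · rintro ⟨h1, h2⟩
      rw [h1, h2]
      exact ⟨h, rfl, rfl⟩
  · rw [Finset.card_eq_zero.2, zero_smul]
    rw [Finset.filter_eq_empty_iff]
    rintro q - ⟨h1, h2, h3⟩
    rw [h2, h3] at h
    exact h h1

open Classical in
theorem L_apply (t : Fin n) (z u : IState n k) :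
    (L t : B0 n k) z u = if MovesRight t u z then 1 else 0 := by
  rw [L, sum_apply]
  simp only [f, ← movesRight_iff_left]
  rw [← Finset.sum_filter, Finset.filter_filter, Finset.sum_const]
  split_ifs with h
  · rw [Finset.card_eq_one.2 ⟨(z, u), _⟩, one_smul]
    ext q
    simp only [Finset.mem_filter, Finset.mem_univ, true_and, Finset.mem_singleton, Prod.ext_iff]
    constructor
    · rintro ⟨-, h1, h2⟩
      exact ⟨h1.symm, h2.symm⟩
    · rintro ⟨h1, h2⟩
      rw [h1, h2]
      exact ⟨h, rfl, rfl⟩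
  · rw [Finset.card_eq_zero.2, zero_smul]
    rw [Finset.filter_eq_empty_iff]
    rintro q - ⟨h1, h2, h3⟩
    rw [h2, h3] at h
    exact h h1

theorem f_self_mul_apply (z : IState n k) (a : B0 n k) (p q : IState n k) :
    (f z z * a) p q = if p = z then a p q else 0 := by
  rw [mul_apply, Finset.sum_eq_single p]
  · by_cases h : p = z <;> simp [f, h]
  · intro y _ hy
    by_cases h : p = z
    · subst h
      simp [f, hy]
    · simp [f, h]
  · simp

theorem mul_f_self_apply (z : IState n k) (a : B0 n k) (p q : IState n k) :
    (a * f z z) p q = if q = z then a p q else 0 := by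
  rw [mul_apply, Finset.sum_eq_single q]
  · by_cases h : q = z <;> simp [f, h]
  · intro y _ hy
    by_cases h : q = z
    · subst h
      simp [f, hy]
    · simp [f, h]
  · simp

theorem f_self_mul_R {t : Fin n} {z u : IState n k} (h : MovesRight t z u) :
    f z z * R t = f z u := by
  ext1 p q
  rw [f_self_mul_apply, R_apply]
  by_cases hp : p = z
  · subst hp
    have : MovesRight t p q ↔ q = u := by
      constructor
      · intro h'
        exact eq_of_cnt_eq fun i => by rw [h i, h' i]
      · rintro rfl
        exact h
    simp [f, this]
  · simp [f, hp]

theorem f_self_mul_L {t : Fin n} {z u : IState n k} (h : MovesRight t u z) :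
    f z z * L t = f z u := by
  ext1 p q
  rw [f_self_mul_apply, L_apply]
  by_cases hp : p = z
  · subst hp
    have : MovesRight t q p ↔ q = u := by
      constructor
      · intro h'
        refine eq_of_cnt_eq fun i => ?_
        have h1 := h i
        have h2 := h' i
        omega
      · rintro rfl
        exact h
    simp [f, this]
  · simp [f, hp]

theorem f_self_mul_U (z : IState n k) (t : Fin n) :
    f z z * U t = (MvPolynomial.X t : PolyU n) • f z z := by
  rw [U_eq_algebraMap, ← Algebra.commutes, Algebra.smul_def]

end B0

/-- Every `z_a` lies between `x_a` and `y_a`, expressed through the counting functions. -/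
def Between (x z y : IState n k) : Prop :=
  ∀ i, (cnt x i ≤ cnt z i ∧ cnt z i ≤ cnt y i) ∨ (cnt y i ≤ cnt z i ∧ cnt z i ≤ cnt x i)

theorem Between.symm {x z y : IState n k} (h : Between x z y) : Between y z x :=
  fun i => (h i).symm

theorem mulExp_eq_zero_iff (x z y : IState n k) (t : Fin n) :
    mulExp x z y t = 0 ↔ (cnt x (t + 1) ≤ cnt z (t + 1) ∧ cnt z (t + 1) ≤ cnt y (t + 1)) ∨
      (cnt y (t + 1) ≤ cnt z (t + 1) ∧ cnt z (t + 1) ≤ cnt x (t + 1)) := by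
  have h := two_mul_mulExp x z y t
  rw [weight_eq_cnt_sub, weight_eq_cnt_sub, weight_eq_cnt_sub] at h
  rw [← Int.natCast_natAbs, ← Int.natCast_natAbs, ← Int.natCast_natAbs] at h
  omega

theorem Between.f_mul_f {x z y : IState n k} (h : Between x z y) :
    B0.f x z * B0.f z y = B0.f x y := by
  have : mulCoeff x z y = 1 :=
    Finset.prod_eq_one fun t _ => by rw [(mulExp_eq_zero_iff x z y t).2 (h (t + 1)), pow_zero]
  rw [B0.f_mul_f, this, one_smul]

theorem Relator.mem_relIdeal {a : B0 n k} (h : Relator a) : a ∈ relIdeal n k :=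
  TwoSidedIdeal.subset_span h

theorem smul_mem_relIdeal (p : PolyU n) {a : B0 n k} (h : a ∈ relIdeal n k) :
    p • a ∈ relIdeal n k := by
  rw [Algebra.smul_def]
  exact Ideal.mul_mem_left _ _ h

theorem f_mem_relIdeal_of_movesRight {s t : Fin n} (hst : (t : ℕ) = s + 1) {z u w : IState n k}
    (h1 : MovesRight s z u) (h2 : MovesRight t u w) : B0.f z w ∈ relIdeal n k := by
  have hb : Between z u w := fun i => by
    have := h1 i
    have := h2 i
    left
    split_ifs at * <;> omega
  have : B0.f z w = B0.f z z * (B0.R s * B0.R t) := by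
    rw [← mul_assoc, B0.f_self_mul_R h1, ← hb.f_mul_f, ← B0.f_self_mul_R h2, ← mul_assoc,
      B0.f_mul_f, mulCoeff_right, one_smul]
  rw [this]
  exact Ideal.mul_mem_left _ _ (Relator.RR s t hst).mem_relIdeal

theorem f_mem_relIdeal_of_movesRight' {s t : Fin n} (hst : (t : ℕ) = s + 1) {z u w : IState n k}
    (h1 : MovesRight s z u) (h2 : MovesRight t u w) : B0.f w z ∈ relIdeal n k := by
  have hb : Between w u z := fun i => by
    have := h1 i
    have := h2 i
    right
    split_ifs at * <;> omega
  have : B0.f w z = B0.f w w * (B0.L t * B0.L s) := by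
    rw [← mul_assoc, B0.f_self_mul_L h2, ← hb.f_mul_f, ← B0.f_self_mul_L h1, ← mul_assoc,
      B0.f_mul_f, mulCoeff_right, one_smul]
  rw [this]
  exact Ideal.mul_mem_left _ _ (Relator.LL s t hst).mem_relIdeal

/-- If some `x_a + 1 < y_a`, a path from `x` to `y` can be chosen in which one coordinate moves
two steps to the right in succession. -/
theorem exists_movesRight_of_cnt_lt {x y : IState n k} (h : ∃ i, cnt x i < cnt y (i + 1)) :
    ∃ (s t : Fin n) (z u w : IState n k), (t : ℕ) = s + 1 ∧ MovesRight s z u ∧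
      MovesRight t u w ∧ Between x z y ∧ Between z w y := by
  classical
  -- The least such `i` is `s + 1`, where `s` is a coordinate of `x` which has to move past `s + 1`.
  obtain ⟨i, hi, hmin⟩ : ∃ i, cnt x i < cnt y (i + 1) ∧ ∀ j < i, ¬ cnt x j < cnt y (j + 1) :=
    ⟨Nat.find h, Nat.find_spec h, fun j hj => Nat.find_min h hj⟩
  have hi0 : i ≠ 0 := by
    rintro rfl
    have := cnt_succ_le y 0
    rw [cnt_zero] at *
    omega
  obtain ⟨s, rfl⟩ : ∃ s, i = s + 1 := ⟨i - 1, by omega⟩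
  have hs := hmin s (by omega)
  have hn : s + 1 < n := by
    by_contra hlt
    rw [cnt_eq_zero y (by omega)] at hi
    have := cnt_nonneg x (s + 1)
    omega
  have hy := cnt_succ_le y (s + 1)
  have hxs := cnt_le_succ_add_one x s
  have hxanti : ∀ i j, i ≤ j → cnt x j ≤ cnt x i := fun i j hij =>
    antitone_nat_of_succ_le (cnt_succ_le x) hij
  have hyanti : ∀ i j, i ≤ j → cnt y j ≤ cnt y i := fun i j hij =>
    antitone_nat_of_succ_le (cnt_succ_le y) hij
  have hsk := hxanti 0 (s + 1) (by omega)
  rw [cnt_zero] at hsk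
  obtain ⟨z, hz⟩ := exists_cnt_eq (k := k) (n := n)
      (fun i => max (cnt x i) (min (cnt x (s + 1)) (cnt y i)))
      (by rw [cnt_zero, cnt_zero]; omega)
      (by rw [cnt_eq_zero x le_rfl, cnt_eq_zero y le_rfl]
          have := cnt_nonneg x (s + 1)
          omega)
      (fun i _ => by
        have := cnt_succ_le x i
        have := cnt_succ_le y i
        omega)
      (fun i _ => by
        have := cnt_le_succ_add_one x i
        have := cnt_le_succ_add_one y i
        omega)
  have z0 := hz s (by omega)
  have z1 := hz (s + 1) (by omega)
  have z2 := hz (s + 1 + 1) (by omega)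
  have z3 := hz (s + 1 + 1 + 1) (by omega)
  have hx1 := hxanti (s + 1) (s + 1 + 1) (by omega)
  have hx2 := hxanti (s + 1) (s + 1 + 1 + 1) (by omega)
  have hy1 := cnt_le_succ_add_one y (s + 1 + 1)
  have move : ∀ (z : IState n k) (t : Fin n), cnt z t = cnt z (t + 1) + 1 →
      cnt z (t + 1) = cnt z (t + 1 + 1) → ∃ u, MovesRight t z u := by
    intro z t h1 h2
    have ha : t.castSucc ∈ z.1 := (mem_iff_cnt z t.castSucc).2 h1
    have hb : t.succ ∉ z.1 := (notMem_iff_cnt z t.succ).2 (by simpa using h2)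
    refine ⟨⟨insert t.succ (z.1.erase t.castSucc), ?_⟩, (movesRight_iff _ _ _).2 ⟨ha, hb, rfl⟩⟩
    rw [Finset.card_insert_of_notMem (by simp [hb]), Finset.card_erase_add_one ha, z.2]
  obtain ⟨u, hu⟩ := move z ⟨s, by omega⟩ (by simp only; omega) (by simp only; omega)
  have u0 := hu (s + 1)
  have u1 := hu (s + 1 + 1)
  have u2 := hu (s + 1 + 1 + 1)
  simp at u0 u1 u2
  obtain ⟨w, hw⟩ := move u ⟨s + 1, by omega⟩ (by simp only; omega) (by simp only; omega)
  refine ⟨⟨s, by omega⟩, ⟨s + 1, by omega⟩, z, u, w, rfl, hu, hw, fun i => ?_, fun i => ?_⟩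
  · by_cases hin : i ≤ n + 1
    · have := hz i hin
      omega
    · simp only [cnt_eq_zero _ (by omega : n + 1 ≤ i)]
      omega
  · have a1 := hu i
    have a2 := hw i
    by_cases hin : i ≤ n + 1
    · have := hz i hin
      simp only at this a1 a2
      by_cases e1 : i = s + 1
      · subst e1
        simp at a1 a2
        omega
      · by_cases e2 : i = s + 1 + 1
        · subst e2
          simp at a1 a2
          omega
        · simp only [e1, e2, if_false] at a1 a2
          omega
    · simp only [cnt_eq_zero _ (by omega : n + 1 ≤ i)]
      omega

/-- If `x` and `y` are far, then `f_{x,y}` vanishes in `B(n, k)`. -/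
theorem Far.f_mem_relIdeal {x y : IState n k} (h : Far x y) : B0.f x y ∈ relIdeal n k := by
  rw [far_iff_cnt, exists_or] at h
  rcases h with h | h
  · obtain ⟨s, t, z, u, w, hst, h1, h2, hz, hw⟩ := exists_movesRight_of_cnt_lt h
    rw [← hz.f_mul_f, ← hw.f_mul_f]
    exact Ideal.mul_mem_left _ _
      (Ideal.mul_mem_right _ _ (f_mem_relIdeal_of_movesRight hst h1 h2))
  · obtain ⟨s, t, z, u, w, hst, h1, h2, hz, hw⟩ := exists_movesRight_of_cnt_lt h
    rw [← hz.symm.f_mul_f, ← hw.symm.f_mul_f]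
    exact Ideal.mul_mem_right _ _
      (Ideal.mul_mem_left _ _ (f_mem_relIdeal_of_movesRight' hst h1 h2))

theorem mem_lines {j m : Fin (n + 1)} {t : Fin n} :
    t ∈ lines j m ↔ (j : ℕ) ≤ t ∧ (t : ℕ) < m := by
  simp only [lines, Finset.mem_filter, Finset.mem_univ, true_and, Fin.lt_def, Fin.le_def,
    Fin.val_succ]
  omega

/-- The case of a single I-state of the relation `p_G f_{x,y} = 0`: here
`U_{j+1} I_z = L_{j+1} R_{j+1} I_z` factors through an I-state to which the relation for the
shorter interval `[j+2, m]` applies. -/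
theorem prod_lines_smul_f_self_mem (d : ℕ) : ∀ (z : IState n k) (j m : Fin (n + 1)),
    (m : ℕ) = j + d + 1 → j ∉ z.1 → m ∉ z.1 → (∀ t, j < t → t < m → t ∈ z.1) →
    (∏ t ∈ lines j m, MvPolynomial.X t : PolyU n) • B0.f z z ∈ relIdeal n k := by
  induction d with
  | zero =>
    intro z j m hd hj hm hz
    have hmn := m.2
    have hl : lines j m = {⟨j, by omega⟩} := by
      ext t
      rw [mem_lines, Finset.mem_singleton, Fin.ext_iff]
      simp only
      omega
    rw [hl, Finset.prod_singleton, ← B0.f_self_mul_U]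
    have e1 : (⟨j, by omega⟩ : Fin n).castSucc = j := rfl
    have e2 : (⟨j, by omega⟩ : Fin n).succ = m := by
      rw [Fin.ext_iff, Fin.val_succ]
      simp only
      omega
    exact (Relator.IU z ⟨j, by omega⟩ (by rwa [e1]) (by rwa [e2])).mem_relIdeal
  | succ d ih =>
    intro z j m hd hj hm hz
    have hmn := m.2
    set t : Fin n := ⟨j, by omega⟩ with ht
    have e1 : t.castSucc = j := rfl
    have e2 : t.succ ∈ z.1 := hz _ (by rw [Fin.lt_def, Fin.val_succ]; simp [ht])
      (by rw [Fin.lt_def, Fin.val_succ]; simp only [ht]; omega)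
    have hl : lines j m = insert t (lines t.succ m) := by
      ext s
      rw [Finset.mem_insert, mem_lines, mem_lines, Fin.ext_iff, Fin.val_succ]
      simp only [ht]
      omega
    obtain ⟨w, hw⟩ : ∃ w, MovesRight t w z := by
      refine ⟨⟨insert t.castSucc (z.1.erase t.succ), ?_⟩,
        (movesRight_iff_left _ _ _).2 ⟨e2, hj, rfl⟩⟩
      rw [Finset.card_insert_of_notMem (by simp [e1, hj]), Finset.card_erase_add_one e2, z.2]
    have hwz := ((movesRight_iff_left _ _ _).1 hw).2.2
    have hmem := ih w t.succ m (by rw [Fin.val_succ]; simp only [ht]; omega)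
      (by rw [hwz]; simp [Fin.ext_iff])
      (by rw [hwz]
          simp only [Finset.mem_insert, Finset.mem_erase, hm, and_false, or_false, e1]
          rw [Fin.ext_iff]
          omega)
      (fun s h1 h2 => by
        rw [hwz]
        simp only [Finset.mem_insert, Finset.mem_erase]
        exact Or.inr ⟨h1.ne', hz s (lt_trans (by rw [Fin.lt_def, Fin.val_succ]; simp [ht]) h1) h2⟩)
    have hmul : mulCoeff z w z = MvPolynomial.X t := by
      unfold mulCoeff
      rw [Finset.prod_eq_single t]
      · have h1 := two_mul_mulExp z w z t
        have h2 := hw (t + 1)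
        rw [weight_self, weight_eq_cnt_sub, weight_eq_cnt_sub, h2] at h1
        simp at h1
        rw [show mulExp z w z t = 1 by omega, pow_one]
      · intro s _ hs
        have h1 := two_mul_mulExp z w z s
        have h2 := hw (s + 1)
        rw [if_neg (by rw [Ne, Fin.ext_iff] at hs; omega)] at h2
        rw [weight_self, weight_eq_cnt_sub, weight_eq_cnt_sub, h2] at h1
        simp at h1
        rw [h1, pow_zero]
      · simp
    have hnot : t ∉ lines t.succ m := by
      rw [mem_lines, Fin.val_succ]
      omega
    have : (∏ t ∈ lines j m, MvPolynomial.X t : PolyU n) • B0.f z z =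
        B0.f z w * ((∏ t ∈ lines t.succ m, MvPolynomial.X t : PolyU n) • B0.f w w) *
          B0.f w z := by
      rw [hl, Finset.prod_insert hnot, mul_smul_comm, smul_mul_assoc, B0.f_mul_f, mulCoeff_right,
        one_smul, B0.f_mul_f, hmul, smul_smul, mul_comm]
    rw [this]
    exact Ideal.mul_mem_right _ _ (Ideal.mul_mem_left _ _ hmem)

/-- For a generating interval `G`, the element `p_G f_{x,y}` vanishes in `B(n, k)`: the generator
`f_{x,y}` factors through an I-state that contains neither end point of `G`. -/
theorem GenInterval.p_smul_f_mem_relIdeal {x y : IState n k} (G : GenInterval x y) :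
    G.p • B0.f x y ∈ relIdeal n k := by
  classical
  obtain ⟨j, m, hjm, hj, hm, hused, hcross⟩ := G
  have hjm' : (j : ℕ) < m := hjm
  have hmn := m.2
  have heq : ∀ i : ℕ, (j : ℕ) < i → i ≤ m → cnt x i = cnt y i := by
    intro i h1 h2
    have := hcross ⟨i - 1, by omega⟩ (mem_lines.2 ⟨by simp only; omega, by simp only; omega⟩)
    rw [weight_eq_cnt_sub] at this
    simp only [show i - 1 + 1 = i by omega] at this
    omega
  have pick : ∀ c, c ∉ x.1 ∩ y.1 → ∃ u : IState n k, (u = x ∨ u = y) ∧ c ∉ u.1 := by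
    intro c hc
    by_cases hx : c ∈ x.1
    · exact ⟨y, Or.inr rfl, fun hy => hc (Finset.mem_inter.2 ⟨hx, hy⟩)⟩
    · exact ⟨x, Or.inl rfl, hx⟩
  obtain ⟨u, hu, hju⟩ := pick j hj
  obtain ⟨v, hv, hmv⟩ := pick m hm
  have huv : ∀ i : ℕ, (j : ℕ) < i → i ≤ m → cnt u i = cnt v i := by
    intro i h1 h2
    have := heq i h1 h2
    rcases hu with rfl | rfl <;> rcases hv with rfl | rfl <;> simp [this]
  obtain ⟨z, hz⟩ := exists_cnt_eq (k := k) (n := n)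
    (fun i => if i ≤ j + 1 then cnt u i else cnt v i)
    (by simp [cnt_zero])
    (by rw [cnt_eq_zero _ le_rfl, cnt_eq_zero _ le_rfl]; simp)
    (fun i _ => by
      have h1 := cnt_succ_le u i
      have h2 := cnt_succ_le v i
      by_cases e : i = j + 1
      · have h3 := huv i (by omega) (by omega)
        simp only [e] at *
        simp
        omega
      · split_ifs <;> omega)
    (fun i _ => by
      have h1 := cnt_le_succ_add_one u i
      have h2 := cnt_le_succ_add_one v i
      by_cases e : i = j + 1
      · have h3 := huv i (by omega) (by omega)
        simp only [e] at *
        simp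
        omega
      · split_ifs <;> omega)
  have hz' : ∀ i : ℕ, cnt z i = if i ≤ j + 1 then cnt u i else cnt v i := by
    intro i
    by_cases hi : i ≤ n + 1
    · exact hz i hi
    · simp only [cnt_eq_zero _ (by omega : n + 1 ≤ i), ite_self]
  have hzv : ∀ i : ℕ, (j : ℕ) < i → cnt z i = cnt v i := by
    intro i hi
    rw [hz' i]
    split_ifs with h
    · exact huv i hi (by omega)
    · rfl
  have hb : Between x z y := by
    intro i
    have := hz' i
    split_ifs at this
    · rcases hu with rfl | rfl <;> omega
    · rcases hv with rfl | rfl <;> omega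
  have hmem := prod_lines_smul_f_self_mem (m - j - 1) z j m (by omega)
    (by rw [notMem_iff_cnt] at hju ⊢
        rw [hz', hz', if_pos (by omega), if_pos le_rfl, hju])
    (by rw [notMem_iff_cnt] at hmv ⊢
        rw [hzv _ hjm', hzv _ (by omega), hmv])
    (fun t h1 h2 => by
      have h1' : (j : ℕ) < t := h1
      have hvt : t ∈ v.1 := by
        have := Finset.mem_inter.1 (hused t h1 h2)
        rcases hv with rfl | rfl
        exacts [this.1, this.2]
      rw [mem_iff_cnt] at hvt ⊢
      rw [hzv _ h1', hzv _ (by omega), hvt])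
  have : (∏ t ∈ OSz.lines j m, MvPolynomial.X t : PolyU n) • B0.f x y =
      B0.f x z * ((∏ t ∈ OSz.lines j m, MvPolynomial.X t : PolyU n) • B0.f z z) * B0.f z y := by
    rw [mul_smul_comm, smul_mul_assoc, B0.f_mul_f, mulCoeff_right, one_smul, hb.f_mul_f]
  change (∏ t ∈ OSz.lines j m, MvPolynomial.X t : PolyU n) • B0.f x y ∈ relIdeal n k
  rw [this]
  exact Ideal.mul_mem_right _ _ (Ideal.mul_mem_left _ _ hmem)

end

section

variable {n k : ℕ}

/-! ### Monomials that survive in `B(n, k)` -/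

/-- A choice of `k` of the lines `0, …, n + 1`, given by its counting function; the line `i` is
chosen when the function drops at `i`. One thinks of the `a`-th coordinate of an I-state as
confined to the two regions adjacent to the `a`-th chosen line. -/
structure Track (k : ℕ) where
  /-- The number of chosen lines in `[i, n + 1]`. -/
  val : ℕ → ℤ
  zero : val 0 = k
  succ_le : ∀ i, val (i + 1) ≤ val i
  le_succ : ∀ i, val i ≤ val (i + 1) + 1

/-- The `a`-th coordinate of `x` is adjacent to the `a`-th chosen line, for each `a`. -/
def Track.Compatible (τ : Track k) (x : IState n k) : Prop :=
  ∀ i, τ.val (i + 1) ≤ cnt x i ∧ cnt x i ≤ τ.val i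

/-- The ideal generated by the variables of the lines that are not chosen. -/
def Track.polyIdeal (n : ℕ) (τ : Track k) : Ideal (PolyU n) :=
  Ideal.span (MvPolynomial.X '' {t : Fin n | τ.val (t + 1) = τ.val (t + 1 + 1)})

theorem Track.X_mem_polyIdeal {τ : Track k} {t : Fin n} (h : τ.val (t + 1) = τ.val (t + 1 + 1)) :
    (MvPolynomial.X t : PolyU n) ∈ τ.polyIdeal n :=
  Ideal.subset_span ⟨t, h, rfl⟩

/-- A state that is reached from a compatible one by crossing only chosen lines is compatible. -/
theorem Track.Compatible.of_cnt_eq {τ : Track k} {x y : IState n k} (hx : τ.Compatible x)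
    (h : ∀ t : Fin n, τ.val (t + 1) = τ.val (t + 1 + 1) → cnt y (t + 1) = cnt x (t + 1)) :
    τ.Compatible y := by
  have h' : ∀ i, τ.val i = τ.val (i + 1) → cnt y i = cnt x i := by
    intro i hi
    rcases i with _ | i
    · rw [cnt_zero, cnt_zero]
    · by_cases hin : i < n
      · exact h ⟨i, hin⟩ hi
      · rw [cnt_eq_zero _ (by omega), cnt_eq_zero _ (by omega)]
  have hup : ∀ d i, i + d = n + 1 → cnt y i ≤ τ.val i := by
    intro d
    induction d with
    | zero =>
      intro i hi
      have := (hx i).2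
      rw [cnt_eq_zero _ (by omega)] at this ⊢
      exact this
    | succ d ih =>
      intro i hi
      have h1 := ih (i + 1) (by omega)
      have h2 := cnt_le_succ_add_one y i
      have h3 := τ.succ_le i
      by_cases h4 : τ.val i = τ.val (i + 1)
      · rw [h' i h4]
        exact (hx i).2
      · omega
  have hlow : ∀ i, τ.val (i + 1) ≤ cnt y i := by
    intro i
    induction i with
    | zero =>
      have := τ.succ_le 0
      rw [cnt_zero, ← τ.zero]
      exact this
    | succ i ih =>
      have h1 := cnt_le_succ_add_one y i
      have h2 := τ.succ_le (i + 1)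
      by_cases h4 : τ.val (i + 1) = τ.val (i + 1 + 1)
      · rw [h' _ h4]
        exact (hx (i + 1)).1
      · omega
  intro i
  refine ⟨hlow i, ?_⟩
  by_cases hi : i ≤ n + 1
  · exact hup (n + 1 - i) i (by omega)
  · have := (hx i).2
    rw [cnt_eq_zero _ (by omega)] at this ⊢
    exact this

theorem Track.mulCoeff_mem {τ : Track k} {x y z : IState n k} (hx : τ.Compatible x)
    (hz : τ.Compatible z) (hy : ¬ τ.Compatible y) : mulCoeff x y z ∈ τ.polyIdeal n := by
  obtain ⟨t, ht, hne⟩ : ∃ t : Fin n, τ.val (t + 1) = τ.val (t + 1 + 1) ∧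
      cnt y (t + 1) ≠ cnt x (t + 1) := by
    by_contra hcon
    push Not at hcon
    exact hy (hx.of_cnt_eq hcon)
  have h1 := hx (t + 1)
  have h2 := hz (t + 1)
  have h3 : mulExp x y z t ≠ 0 := by
    rw [Ne, mulExp_eq_zero_iff]
    omega
  exact Ideal.mem_of_dvd _ ((dvd_pow_self _ h3).trans
    (Finset.dvd_prod_of_mem _ (Finset.mem_univ t))) (Track.X_mem_polyIdeal ht)

/-- The kernel of the action of `B₀(n, k)` on the sum of copies of `𝔽₂[U₁, …, Uₙ] / (U_i)`, with
`i` running over the lines that are not chosen, indexed by the compatible I-states; `f_{x,y}` maps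
the summand of `y` to that of `x` by multiplication with `∏ U_i ^ max(v_i(x, y), 0)`. -/
def Track.ideal (n : ℕ) (τ : Track k) : TwoSidedIdeal (B0 n k) :=
  TwoSidedIdeal.mk' {a | ∀ x y, τ.Compatible x → τ.Compatible y → a x y ∈ τ.polyIdeal n}
    (fun _ _ _ _ => Ideal.zero_mem _)
    (fun ha hb x y hx hy => Ideal.add_mem _ (ha x y hx hy) (hb x y hx hy))
    (fun ha x y hx hy => Ideal.neg_mem_iff _ |>.2 (ha x y hx hy))
    (fun {a b} hb x z hx hz => by
      rw [B0.mul_apply]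
      refine Ideal.sum_mem _ fun y _ => ?_
      by_cases hy : τ.Compatible y
      · exact Ideal.mul_mem_left _ _ (Ideal.mul_mem_left _ _ (hb y z hy hz))
      · exact Ideal.mul_mem_right _ _ (Track.mulCoeff_mem hx hz hy))
    (fun {a b} ha x z hx hz => by
      rw [B0.mul_apply]
      refine Ideal.sum_mem _ fun y _ => ?_
      by_cases hy : τ.Compatible y
      · exact Ideal.mul_mem_left _ _ (Ideal.mul_mem_right _ _ (ha x y hx hy))
      · exact Ideal.mul_mem_right _ _ (Track.mulCoeff_mem hx hz hy))

theorem Track.mem_ideal {τ : Track k} {a : B0 n k} :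
    a ∈ τ.ideal n ↔ ∀ x y, τ.Compatible x → τ.Compatible y → a x y ∈ τ.polyIdeal n :=
  TwoSidedIdeal.mem_mk' _ _ _ _ _ _ _

theorem Track.relator_mem_ideal (τ : Track k) {a : B0 n k} (ha : Relator a) : a ∈ τ.ideal n := by
  rw [Track.mem_ideal]
  intro x z hx hz
  -- Two consecutive moves of a coordinate in one direction lead to incompatible states.
  have key : ∀ {s t : Fin n} {z u w : IState n k}, (t : ℕ) = s + 1 → MovesRight s z u →
      MovesRight t u w → τ.Compatible z → τ.Compatible w → False := by
    intro s t z u w hst h1 h2 hz hw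
    have := (hw (s + 1 + 1)).2
    have := (hz (s + 1)).1
    have a1 := h1 (s + 1)
    have a2 := h1 (s + 1 + 1)
    have b1 := h2 (s + 1)
    have b2 := h2 (s + 1 + 1)
    rw [hst] at b1 b2
    simp at a1 a2 b1 b2
    have := cnt_succ_le u (s + 1)
    have := cnt_le_succ_add_one u (s + 1)
    have := cnt_succ_le w (s + 1)
    omega
  cases ha with
  | RR s t hst =>
    rw [B0.mul_apply]
    refine Ideal.sum_mem _ fun y _ => ?_
    rw [B0.R_apply, B0.R_apply]
    split_ifs with h1 h2
    · exact (key hst h1 h2 hx hz).elim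
    all_goals simp
  | LL s t hst =>
    rw [B0.mul_apply]
    refine Ideal.sum_mem _ fun y _ => ?_
    rw [B0.L_apply, B0.L_apply]
    split_ifs with h1 h2
    · exact (key hst h2 h1 hz hx).elim
    all_goals simp
  | IU w t h1 h2 =>
    rw [B0.f_self_mul_U, B0.smul_apply]
    by_cases hxw : x = w
    · refine Ideal.mul_mem_right _ _ (Track.X_mem_polyIdeal ?_)
      subst hxw
      rw [notMem_iff_cnt, Fin.val_castSucc] at h1
      rw [notMem_iff_cnt, Fin.val_succ] at h2
      have := (hx t).1
      have := (hx (t + 1 + 1)).2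
      have := τ.succ_le (t + 1)
      omega
    · simp [B0.f, hxw]

theorem Track.relIdeal_apply_mem (τ : Track k) {a : B0 n k} (ha : a ∈ relIdeal n k)
    {x y : IState n k} (hx : τ.Compatible x) (hy : τ.Compatible y) : a x y ∈ τ.polyIdeal n := by
  have h : TwoSidedIdeal.span {a : B0 n k | Relator a} ≤ τ.ideal n :=
    TwoSidedIdeal.span_le.2 fun b hb => τ.relator_mem_ideal hb
  exact Track.mem_ideal.1 (h ha) x y hx hy

variable (x y : IState n k) (e : Fin n →₀ ℕ)

/-- The coordinate `i` belongs to both `x` and `y`. -/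
def UsedAt (i : ℕ) : Prop := cnt x i = cnt x (i + 1) + 1 ∧ cnt y i = cnt y (i + 1) + 1

/-- The coordinate `i`, used by both `x` and `y`, is to be confined to the line on its left:
this is so if all lines between `i` and the last coordinate before `i` that is not used by both are
not crossed and have to be chosen because they occur in the monomial `U ^ e`. -/
def UsesLeft : ℕ → Prop
  | 0 => False
  | i + 1 => UsedAt x y (i + 1) ∧ cnt x (i + 1) = cnt y (i + 1) ∧
      (∃ h : i < n, e ⟨i, h⟩ ≠ 0) ∧ (¬ UsedAt x y i ∨ UsesLeft i)

variable {x y e}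

theorem usedAt_iff (c : Fin (n + 1)) : UsedAt x y c ↔ c ∈ x.1 ∩ y.1 := by
  rw [Finset.mem_inter, mem_iff_cnt, mem_iff_cnt, UsedAt]

theorem UsesLeft.exists_start {i : ℕ} (h : UsesLeft x y e i) :
    ∃ j < i, ¬ UsedAt x y j ∧ ∀ s, j < s → s ≤ i → UsedAt x y s ∧ cnt x s = cnt y s ∧
      ∃ h : s - 1 < n, e ⟨s - 1, h⟩ ≠ 0 := by
  induction i with
  | zero => exact h.elim
  | succ i ih =>
    obtain ⟨h1, h2, h3, h4⟩ := h
    have last : ∀ s, s = i + 1 → UsedAt x y s ∧ cnt x s = cnt y s ∧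
        ∃ h : s - 1 < n, e ⟨s - 1, h⟩ ≠ 0 := by
      rintro s rfl
      exact ⟨h1, h2, h3⟩
    rcases h4 with h4 | h4
    · exact ⟨i, by omega, h4, fun s _ _ => last s (by omega)⟩
    · obtain ⟨j, hj, hju, hall⟩ := ih h4
      refine ⟨j, by omega, hju, fun s hs1 hs2 => ?_⟩
      by_cases hs : s = i + 1
      · exact last s hs
      · exact hall s hs1 (by omega)

open Classical in
/-- If `x` and `y` are not far and `p_G` does not divide `U ^ e` for any generating interval `G`,
then `k` lines can be chosen so that both `x` and `y` are compatible with the choice and each line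
occurring in `U ^ e` is chosen. -/
theorem exists_track (hfar : ¬ Far x y) (he : ∀ G : GenInterval x y, ∃ t ∈ G.lines, e t = 0) :
    ∃ τ : Track k, τ.Compatible x ∧ τ.Compatible y ∧
      ∀ t : Fin n, e t ≠ 0 → τ.val (t + 1) ≠ τ.val (t + 1 + 1) := by
  rw [far_iff_cnt] at hfar
  push Not at hfar
  let ν : ℕ → ℤ
    | 0 => k
    | i + 1 => if UsesLeft x y e i then max (cnt x (i + 1)) (cnt y (i + 1))
        else min (cnt x i) (cnt y i)
  have hs : ∀ i, ν (i + 1) = if UsesLeft x y e i then max (cnt x (i + 1)) (cnt y (i + 1))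
        else min (cnt x i) (cnt y i) := fun i => rfl
  have hle : ∀ i, ν (i + 1) ≤ min (cnt x i) (cnt y i) := by
    intro i
    have := hfar i
    have := cnt_succ_le x i
    have := cnt_succ_le y i
    rw [hs]
    split_ifs <;> omega
  have hge : ∀ i, max (cnt x i) (cnt y i) ≤ ν i := by
    intro i
    rcases i with _ | i
    · rw [cnt_zero, cnt_zero, max_self]
    · have := hfar i
      have := cnt_succ_le x i
      have := cnt_succ_le y i
      rw [hs]
      split_ifs <;> omega
  refine ⟨⟨ν, rfl, fun i => ?_, fun i => ?_⟩, fun i => ?_, fun i => ?_, fun t ht => ?_⟩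
  · have := hle i
    have := hge i
    omega
  · rw [hs]
    split_ifs with hL
    · rcases i with _ | i
      · exact hL.elim
      · rw [hs]
        obtain ⟨⟨h1, h2⟩, h3, -, h4⟩ := hL
        have hx := cnt_succ_le x i
        have hy := cnt_succ_le y i
        have hx' := cnt_le_succ_add_one x i
        have hy' := cnt_le_succ_add_one y i
        split_ifs with h5
        · omega
        · have : ¬ UsedAt x y i := by tauto
          unfold UsedAt at this
          omega
    · rcases i with _ | i
      · change (k : ℤ) ≤ _
        rw [cnt_zero, cnt_zero]
        omega
      · have := hle i
        have := cnt_le_succ_add_one x i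
        have := cnt_le_succ_add_one y i
        omega
  · have := hle i
    have := hge i
    exact ⟨by simp only; omega, by simp only; omega⟩
  · have := hle i
    have := hge i
    exact ⟨by simp only; omega, by simp only; omega⟩
  · obtain ⟨i, hi⟩ := t
    simp only at ht ⊢
    -- A violation at the line `i + 1` yields a generating interval that ends at `i + 1`.
    intro heq
    by_cases hv : cnt x (i + 1) = cnt y (i + 1)
    swap
    · have := hle (i + 1)
      have := hge (i + 1)
      omega
    have mk : ∀ j ≤ i, ¬ UsedAt x y j → ¬ UsedAt x y (i + 1) →
        (∀ s, j < s → s ≤ i → UsedAt x y s ∧ cnt x s = cnt y s ∧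
          ∃ h : s - 1 < n, e ⟨s - 1, h⟩ ≠ 0) → False := by
      intro j hj h1 h2 h3
      obtain ⟨t, ht1, ht2⟩ := he
        { j := ⟨j, by omega⟩
          m := ⟨i + 1, by omega⟩
          lt := by rw [Fin.lt_def]; simp only; omega
          left_not_used := by rwa [← usedAt_iff]
          right_not_used := by rwa [← usedAt_iff]
          used := fun t h4 h5 => by
            rw [← usedAt_iff]
            rw [Fin.lt_def] at h4 h5
            simp only at h4 h5
            exact (h3 t h4 (by omega)).1
          not_crossed := fun t h4 => by
            rw [mem_lines] at h4
            simp only at h4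
            rw [weight_eq_cnt_sub, sub_eq_zero]
            by_cases hti : t.val = i
            · rw [hti, hv]
            · exact (h3 (t + 1) (by omega) (by omega)).2.1.symm }
      have ht3 := mem_lines.1 ht1
      simp only at ht3
      by_cases hti : t.val = i
      · exact ht (by rw [← ht2]; congr 1; exact Fin.ext hti.symm)
      · obtain ⟨-, -, h4, h5⟩ := h3 (t + 1) (by omega) (by omega)
        exact h5 ht2
    have hx := cnt_succ_le x i
    have hy := cnt_succ_le y i
    have hx' := cnt_le_succ_add_one x i
    have hy' := cnt_le_succ_add_one y i
    have hx2 := cnt_succ_le x (i + 1)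
    have hy2 := cnt_succ_le y (i + 1)
    have hx2' := cnt_le_succ_add_one x (i + 1)
    have hy2' := cnt_le_succ_add_one y (i + 1)
    rw [hs i, hs (i + 1)] at heq
    by_cases hu : UsedAt x y (i + 1)
    · have hL : UsesLeft x y e (i + 1) ↔ (¬ UsedAt x y i ∨ UsesLeft x y e i) := by
        constructor
        · rintro ⟨-, -, -, h⟩
          exact h
        · intro h
          exact ⟨hu, hv, ⟨hi, ht⟩, h⟩
      by_cases h1 : UsesLeft x y e i
      · rw [if_pos h1, if_pos (hL.2 (Or.inr h1))] at heq
        unfold UsedAt at hu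
        omega
      · rw [if_neg h1] at heq
        by_cases h2 : UsedAt x y i
        · rw [if_neg (by tauto)] at heq
          unfold UsedAt at hu h2
          omega
        · rw [if_pos (by tauto)] at heq
          unfold UsedAt at hu h2
          omega
    · rw [if_neg (fun h : UsesLeft x y e (i + 1) => hu h.1)] at heq
      by_cases h2 : UsedAt x y i
      · by_cases h1 : UsesLeft x y e i
        · obtain ⟨j, hj, hju, hall⟩ := h1.exists_start
          exact mk j (by omega) hju hu hall
        · rw [if_neg h1] at heq
          unfold UsedAt at h2
          omega
      · exact mk i le_rfl h2 hu fun s _ _ => by omega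

/-- If `x` and `y` are not far, a monomial that is not divisible by any `p_G` does not occur in the
`(x, y)`-component of an element of the ideal of relations. -/
theorem coeff_eq_zero_of_mem_relIdeal (hfar : ¬ Far x y)
    (he : ∀ G : GenInterval x y, ∃ t ∈ G.lines, e t = 0) {a : B0 n k} (ha : a ∈ relIdeal n k) :
    MvPolynomial.coeff e (a x y) = 0 := by
  obtain ⟨τ, hx, hy, hτ⟩ := exists_track hfar he
  have h := τ.relIdeal_apply_mem ha hx hy
  rw [Track.polyIdeal, MvPolynomial.mem_ideal_span_X_image] at h
  by_contra hne
  obtain ⟨t, ht, het⟩ := h e (MvPolynomial.mem_support_iff.2 hne)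
  exact hτ t het ht

end

section

variable {n k : ℕ} {S : Finset (Fin n)}

/-! ### Coefficients in the exterior algebra and in `B(n, k)` -/

/-- A linear form on `N` through which `g` factors, if it factors through the surjection `π`. -/
def factorThrough {M N : Type*} [AddCommGroup M] [AddCommGroup N] [Module (ZMod 2) M]
    [Module (ZMod 2) N] (π : M →ₗ[ZMod 2] N) (hπ : Function.Surjective π)
    (g : M →ₗ[ZMod 2] ZMod 2) : N →ₗ[ZMod 2] ZMod 2 :=
  g ∘ₗ (π.exists_rightInverse_of_surjective (LinearMap.range_eq_top.2 hπ)).choose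

theorem factorThrough_apply {M N : Type*} [AddCommGroup M] [AddCommGroup N] [Module (ZMod 2) M]
    [Module (ZMod 2) N] (π : M →ₗ[ZMod 2] N) (hπ : Function.Surjective π)
    (g : M →ₗ[ZMod 2] ZMod 2) (h : ∀ m, π m = 0 → g m = 0) (m : M) :
    factorThrough π hπ g (π m) = g m := by
  have hs := (π.exists_rightInverse_of_surjective (LinearMap.range_eq_top.2 hπ)).choose_spec
  have h1 := LinearMap.congr_fun hs (π m)
  rw [factorThrough, LinearMap.comp_apply, ← sub_eq_zero, ← map_sub]
  exact h _ (by rw [map_sub, sub_eq_zero]; exact h1)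

/-- The monomial `∏ C_i`, `i ∈ σ`. -/
def extMon (σ : Finset S) : Ext S := ∏ i ∈ σ, C i

/-- The exponent vector of `∏ C_i`, `i ∈ σ`. -/
def extExp (σ : Finset S) : S →₀ ℕ := Finsupp.indicator σ fun _ _ => 1

theorem extExp_apply (σ : Finset S) (i : S) : extExp σ i = if i ∈ σ then 1 else 0 := by
  simp [extExp, Finsupp.indicator_apply]

theorem extExp_injective : Function.Injective (extExp (S := S)) := by
  intro σ τ h
  ext i
  have := DFunLike.congr_fun h i
  rw [extExp_apply, extExp_apply] at this
  split_ifs at this <;> simp_all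

theorem extMon_eq (σ : Finset S) :
    extMon σ = toExt S (MvPolynomial.monomial (extExp σ) 1) := by
  rw [MvPolynomial.monomial_eq, map_one, one_mul, Finsupp.prod_of_support_subset (s := σ)]
  · rw [map_prod, extMon]
    refine Finset.prod_congr rfl fun i hi => ?_
    rw [extExp_apply, if_pos hi, pow_one, C]
  · exact Finsupp.support_indicator_subset _ _
  · simp

/-- The coefficient of `∏ C_i`, `i ∈ σ`, in an element of the exterior algebra. -/
def extCoeff (σ : Finset S) : Ext S →ₗ[ZMod 2] ZMod 2 :=
  factorThrough (toExt S).toLinearMap toExt_surjective (MvPolynomial.lcoeff (ZMod 2) (extExp σ))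

theorem extCoeff_toExt (σ : Finset S) (p : MvPolynomial S (ZMod 2)) :
    extCoeff σ (toExt S p) = MvPolynomial.coeff (extExp σ) p := by
  refine factorThrough_apply _ _ _ (fun m hm => ?_) p
  have hm' : m ∈ sqIdeal S := (toExt_eq_zero_iff m).1 hm
  have hs : sqIdeal S = Ideal.span ((fun s => MvPolynomial.monomial s (1 : ZMod 2)) ''
      Set.range fun i : S => Finsupp.single i 2) := by
    rw [sqIdeal, ← Set.range_comp]
    congr 2
    ext i : 1
    simp [MvPolynomial.X_pow_eq_monomial]
  rw [hs, MvPolynomial.mem_ideal_span_monomial_image] at hm'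
  by_contra hne
  obtain ⟨_, ⟨i, rfl⟩, hi⟩ := hm' _ (MvPolynomial.mem_support_iff.2 hne)
  have := hi i
  rw [Finsupp.single_eq_same, extExp_apply] at this
  split_ifs at this <;> omega

theorem extCoeff_extMon (σ τ : Finset S) :
    extCoeff σ (extMon τ) = if σ = τ then 1 else 0 := by
  classical
  rw [extMon_eq, extCoeff_toExt, MvPolynomial.coeff_monomial]
  simp only [extExp_injective.eq_iff, eq_comm]

theorem extCoeff_dC (σ : Finset S) (i : S) (c : Ext S) :
    extCoeff σ (dC i c) = if i ∈ σ then 0 else extCoeff (insert i σ) c := by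
  obtain ⟨p, rfl⟩ := toExt_surjective c
  rw [dC_toExt, extCoeff_toExt, extCoeff_toExt, MvPolynomial.coeff_pderiv, extExp_apply]
  split_ifs with h
  · rw [Nat.cast_one, one_add_one_eq_two, show (2 : ZMod 2) = 0 from rfl, mul_zero]
  · rw [Nat.cast_zero, zero_add, mul_one]
    congr 1
    ext j
    rw [Finsupp.add_apply, extExp_apply, extExp_apply, Finsupp.single_apply]
    by_cases hj : j = i
    · subst hj; simp [h]
    · simp [hj, Ne.symm hj]

theorem span_extMon : Submodule.span (ZMod 2) (Set.range (extMon (S := S))) = ⊤ := by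
  rw [eq_top_iff]
  rintro c -
  obtain ⟨p, rfl⟩ := toExt_surjective c
  induction p using MvPolynomial.induction_on' with
  | add p q hp hq =>
    rw [map_add]
    exact Submodule.add_mem _ hp hq
  | monomial m r =>
    have hr : MvPolynomial.monomial m r = r • MvPolynomial.monomial m (1 : ZMod 2) := by
      rw [MvPolynomial.smul_monomial, smul_eq_mul, mul_one]
    rw [hr, map_smul]
    refine Submodule.smul_mem _ _ ?_
    by_cases hm : ∃ i, 2 ≤ m i
    · obtain ⟨i, hi⟩ := hm
      have : toExt S (MvPolynomial.monomial m 1) = 0 := by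
        rw [toExt_eq_zero_iff]
        have hdvd : (MvPolynomial.X i ^ 2 : MvPolynomial S (ZMod 2)) ∣
            MvPolynomial.monomial m 1 := by
          rw [MvPolynomial.X_pow_eq_monomial, MvPolynomial.monomial_dvd_monomial]
          exact ⟨Or.inr (Finsupp.single_le_iff.2 hi), one_dvd _⟩
        exact Ideal.mem_of_dvd _ hdvd (Ideal.subset_span ⟨i, rfl⟩)
      rw [this]
      exact Submodule.zero_mem _
    · push Not at hm
      refine Submodule.subset_span ⟨m.support, ?_⟩
      rw [extMon_eq]
      suffices h : extExp m.support = m by rw [h]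
      ext i
      rw [extExp_apply]
      have := hm i
      split_ifs with h
      · rw [Finsupp.mem_support_iff] at h
        omega
      · rw [Finsupp.mem_support_iff, not_not] at h
        exact h.symm

variable (x y : IState n k)

/-- The monomial `U ^ e` is not divisible by `p_G` for any generating interval `G`; equivalently,
if `x` and `y` are not far, `U ^ e f_{x,y}` is not zero in `B(n, k)`. -/
def Survives (e : Fin n →₀ ℕ) : Prop := ∀ G : GenInterval x y, ∃ t ∈ G.lines, e t = 0

/-- The coefficient of `U ^ e f_{x,y}` in an element of `B(n, k)`, for a monomial `U ^ e` that
survives. -/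
def bCoeff (e : Fin n →₀ ℕ) : B n k →ₗ[ZMod 2] ZMod 2 :=
  factorThrough (toB n k).toLinearMap toB_surjective
    (MvPolynomial.lcoeff (ZMod 2) e ∘ₗ (LinearMap.proj y ∘ₗ LinearMap.proj x :
      (IState n k → IState n k → PolyU n) →ₗ[ZMod 2] PolyU n))

variable {x y}

theorem GenInterval.p_eq (G : GenInterval x y) :
    G.p = MvPolynomial.monomial (∑ t ∈ G.lines, Finsupp.single t 1) 1 := by
  rw [MvPolynomial.monomial_sum_one]
  rfl

theorem sum_single_one_apply {α : Type*} [DecidableEq α] (s : Finset α) (t : α) :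
    (∑ i ∈ s, Finsupp.single i 1 : α →₀ ℕ) t = if t ∈ s then 1 else 0 := by
  simp [Finsupp.finsetSum_apply, Finsupp.single_apply]

theorem GenInterval.p_dvd_iff (G : GenInterval x y) (e : Fin n →₀ ℕ) :
    G.p ∣ MvPolynomial.monomial e (1 : ZMod 2) ↔ ∀ t ∈ G.lines, e t ≠ 0 := by
  rw [G.p_eq, MvPolynomial.monomial_dvd_monomial]
  simp only [one_ne_zero, false_or, dvd_refl, and_true]
  constructor
  · intro h t ht
    have := h t
    rw [sum_single_one_apply, if_pos ht] at this
    omega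
  · intro h t
    rw [sum_single_one_apply]
    split_ifs with ht
    · have := h t ht
      omega
    · omega

theorem survives_iff (e : Fin n →₀ ℕ) :
    Survives x y e ↔ ∀ G : GenInterval x y, ¬ G.p ∣ MvPolynomial.monomial e (1 : ZMod 2) := by
  refine forall_congr' fun G => ?_
  rw [G.p_dvd_iff]
  push Not
  rfl

theorem bCoeff_toB (hfar : ¬ Far x y) {e : Fin n →₀ ℕ} (he : Survives x y e) (a : B0 n k) :
    bCoeff x y e (toB n k a) = MvPolynomial.coeff e (a x y) :=
  factorThrough_apply (toB n k).toLinearMap _ _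
    (fun m hm => coeff_eq_zero_of_mem_relIdeal hfar he ((toB_eq_zero_iff m).1 hm)) a

variable (x y) in
/-- The element `U ^ e f_{x,y}` of `B(n, k)`. -/
def bMon (e : Fin n →₀ ℕ) : B n k :=
  toB n k ((MvPolynomial.monomial e 1 : PolyU n) • B0.f x y)

theorem bMon_eq_zero {e : Fin n →₀ ℕ} (he : ¬ Survives x y e) : bMon x y e = 0 := by
  rw [survives_iff] at he
  push Not at he
  obtain ⟨G, q, hq⟩ := he
  rw [bMon, toB_eq_zero_iff, hq, mul_comm, mul_smul]
  exact smul_mem_relIdeal _ G.p_smul_f_mem_relIdeal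

theorem bCoeff_bMon (hfar : ¬ Far x y) {e : Fin n →₀ ℕ} (he : Survives x y e)
    (e' : Fin n →₀ ℕ) : bCoeff x y e (bMon x y e') = if e = e' then 1 else 0 := by
  rw [bMon, bCoeff_toB hfar he, B0.smul_apply]
  simp [B0.f, MvPolynomial.coeff_monomial, eq_comm]

open Classical in
theorem bCoeff_U_mul (hfar : ¬ Far x y) {e : Fin n →₀ ℕ} (he : Survives x y e) (t : Fin n)
    (b : B n k) :
    bCoeff x y e (U t * b) = if e t = 0 then 0 else bCoeff x y (e - Finsupp.single t 1) b := by
  obtain ⟨a, rfl⟩ := toB_surjective b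
  have he' : Survives x y (e - Finsupp.single t 1) := fun G => by
    obtain ⟨s, hs, hs0⟩ := he G
    exact ⟨s, hs, by rw [Finsupp.tsub_apply, hs0, zero_tsub]⟩
  rw [U, ← map_mul, bCoeff_toB hfar he, bCoeff_toB hfar he', B0.U_eq_algebraMap,
    ← Algebra.smul_def,
    B0.smul_apply, MvPolynomial.coeff_X_mul']
  simp only [Finsupp.mem_support_iff, ite_not]

/-! ### The `(x, y)`-component of `B(n, k, S)` -/

/-- The exponent vector of `∏ U_i`, `i ∈ σ`. -/
def lineExp (σ : Finset S) : Fin n →₀ ℕ := ∑ i ∈ σ, Finsupp.single (i : Fin n) 1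

theorem lineExp_apply (σ : Finset S) (i : S) : lineExp σ i = if i ∈ σ then 1 else 0 := by
  classical
  simp [lineExp, Finsupp.finsetSum_apply, Finsupp.single_apply]

theorem lineExp_apply_of_notMem (σ : Finset S) {t : Fin n} (ht : t ∉ S) : lineExp σ t = 0 := by
  classical
  simp only [lineExp, Finsupp.finsetSum_apply, Finsupp.single_apply]
  refine Finset.sum_eq_zero fun i _ => if_neg ?_
  rintro rfl
  exact ht i.2

theorem lineExp_le_one (σ : Finset S) (t : Fin n) : lineExp σ t ≤ 1 := by
  by_cases ht : t ∈ S
  · have := lineExp_apply σ ⟨t, ht⟩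
    simp only at this
    split_ifs at this <;> omega
  · rw [lineExp_apply_of_notMem σ ht]
    omega

variable (x y) in
/-- The complex `I_x B(n, k, S) I_y` is multigraded, with `U_i` and `C_i` both of degree the `i`-th
unit vector. Its basis elements in degree `g` are `U ^ (g - 1_σ) f_{x,y} ∏ C_i`, `i ∈ σ`, for those
sets `σ` that are allowed in degree `g` in the following sense. -/
def Allowed (g : Fin n →₀ ℕ) (σ : Finset S) : Prop :=
  (∀ i ∈ σ, g i ≠ 0) ∧ Survives x y (g - lineExp σ)

variable (x y) in
/-- The element `U ^ (g - 1_σ) f_{x,y} ∏ C_i`, `i ∈ σ`, of multidegree `g`. -/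
def mon (g : Fin n →₀ ℕ) (σ : Finset S) : BS k S := bMon x y (g - lineExp σ) ⊗ₜ extMon σ

open Classical in
variable (x y) in
/-- The coefficient of `mon x y g σ` in an element of `B(n, k, S)`; zero if `σ` is not allowed. -/
def coef (g : Fin n →₀ ℕ) (σ : Finset S) : BS k S →ₗ[ZMod 2] ZMod 2 :=
  if Allowed x y g σ then
    (TensorProduct.lid (ZMod 2) (ZMod 2)).toLinearMap ∘ₗ
      TensorProduct.map (bCoeff x y (g - lineExp σ)) (extCoeff σ)
  else 0

theorem coef_tmul {g : Fin n →₀ ℕ} {σ : Finset S} (h : Allowed x y g σ) (b : B n k) (c : Ext S) :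
    coef x y g σ (b ⊗ₜ c) = bCoeff x y (g - lineExp σ) b * extCoeff σ c := by
  simp [coef, h]

theorem coef_eq_zero {g : Fin n →₀ ℕ} {σ : Finset S} (h : ¬ Allowed x y g σ) :
    coef x y g σ = 0 := by
  simp [coef, h]

theorem Allowed.of_coef_ne_zero {g : Fin n →₀ ℕ} {σ : Finset S} {b : BS k S}
    (h : coef x y g σ b ≠ 0) : Allowed x y g σ := by
  by_contra h'
  rw [coef_eq_zero h'] at h
  exact h rfl

theorem Allowed.sub_add {g : Fin n →₀ ℕ} {σ : Finset S} (h : Allowed x y g σ) :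
    g - lineExp σ + lineExp σ = g := by
  refine tsub_add_cancel_of_le fun t => ?_
  by_cases ht : t ∈ S
  · have := lineExp_apply σ ⟨t, ht⟩
    simp only at this
    rw [this]
    split_ifs with hσ
    · have := h.1 _ hσ
      simp only at this
      omega
    · omega
  · rw [lineExp_apply_of_notMem σ ht]
    omega

open Classical in
theorem coef_mon (hfar : ¬ Far x y) (g : Fin n →₀ ℕ) {g' : Fin n →₀ ℕ} (σ : Finset S)
    {σ' : Finset S} (h' : Allowed x y g' σ') :
    coef x y g σ (mon x y g' σ') = if g = g' ∧ σ = σ' then 1 else 0 := by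
  by_cases h : Allowed x y g σ
  · rw [mon, coef_tmul h, bCoeff_bMon hfar h.2, extCoeff_extMon]
    by_cases hσ : σ = σ'
    · subst hσ
      have : g - lineExp σ = g' - lineExp σ ↔ g = g' :=
        ⟨fun e => by rw [← h.sub_add, ← h'.sub_add, e], fun e => by rw [e]⟩
      simp [this]
    · simp [hσ]
  · rw [coef_eq_zero h, if_neg, LinearMap.zero_apply]
    rintro ⟨rfl, rfl⟩
    exact h h'

theorem allowed_insert_iff {g : Fin n →₀ ℕ} {τ : Finset S} (h : Allowed x y g τ) (i : S) :
    Allowed x y g (insert i τ) ↔ g i ≠ 0 := by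
  constructor
  · intro h'
    exact h'.1 i (Finset.mem_insert_self i τ)
  · intro hi
    refine ⟨fun j hj => ?_, fun G => ?_⟩
    · rcases Finset.mem_insert.1 hj with rfl | hj
      exacts [hi, h.1 j hj]
    · obtain ⟨t, ht, ht0⟩ := h.2 G
      refine ⟨t, ht, ?_⟩
      have hle : lineExp τ t ≤ lineExp (insert i τ) t := by
        classical
        exact (Finset.sum_le_sum_of_subset (Finset.subset_insert i τ) :
          lineExp τ ≤ lineExp (insert i τ)) t
      rw [Finsupp.tsub_apply] at ht0 ⊢
      omega

theorem lineExp_insert {τ : Finset S} {i : S} (hi : i ∉ τ) :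
    lineExp (insert i τ) = lineExp τ + Finsupp.single (i : Fin n) 1 := by
  rw [lineExp, Finset.sum_insert hi, add_comm, lineExp]

/-- The differential in terms of coefficients. -/
theorem coef_d (hfar : ¬ Far x y) {g : Fin n →₀ ℕ} {τ : Finset S} (h : Allowed x y g τ)
    (b : BS k S) :
    coef x y g τ (d k S b) = ∑ i ∈ Finset.univ \ τ, coef x y g (insert i τ) b := by
  induction b using TensorProduct.induction_on with
  | zero => simp
  | add a b ha hb => simp only [map_add, ha, hb, Finset.sum_add_distrib]
  | tmul b c =>
    rw [d_tmul, map_sum, ← Finset.sum_sdiff (Finset.subset_univ τ)]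
    rw [Finset.sum_eq_zero (s := τ), add_zero]
    · refine Finset.sum_congr rfl fun i hi => ?_
      have hi' : i ∉ τ := (Finset.mem_sdiff.1 hi).2
      rw [coef_tmul h, extCoeff_dC, if_neg hi', bCoeff_U_mul hfar h.2]
      have e : (g - lineExp τ) i = g i := by
        rw [Finsupp.tsub_apply, lineExp_apply, if_neg hi', tsub_zero]
      rw [e]
      by_cases hg : g i = 0
      · rw [if_pos hg, zero_mul, coef_eq_zero, LinearMap.zero_apply]
        rw [allowed_insert_iff h, not_not]
        exact hg
      · rw [if_neg hg, coef_tmul ((allowed_insert_iff h i).2 hg), lineExp_insert hi',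
          tsub_add_eq_tsub_tsub]
    · intro i hi
      rw [coef_tmul h, extCoeff_dC, if_pos hi, mul_zero]

variable (S) in
/-- The idempotent `I_x` of `B(n, k, S)`. -/
abbrev idemElt (x : IState n k) : BS k S := toB n k (B0.f x x) ⊗ₜ 1

theorem toB_smul (p : PolyU n) (a : B0 n k) (r : ZMod 2) :
    toB n k ((r • p) • a) = r • toB n k (p • a) := by
  rw [smul_assoc, map_smul]

variable (S x y) in
/-- The subcomplex `I_x B(n, k, S) I_y`, as the span of its basis elements. -/
def component : Submodule (ZMod 2) (BS k S) :=
  Submodule.span (ZMod 2) {m | ∃ g σ, Allowed x y g σ ∧ m = mon x y g σ}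

theorem mon_mem_component {g : Fin n →₀ ℕ} {σ : Finset S} (h : Allowed x y g σ) :
    mon x y g σ ∈ component S x y :=
  Submodule.subset_span ⟨g, σ, h, rfl⟩

theorem toB_f_mul_mul (a : B0 n k) :
    toB n k (B0.f x x) * toB n k a * toB n k (B0.f y y) = toB n k (a x y • B0.f x y) := by
  rw [← map_mul, ← map_mul]
  congr 1
  ext1 p q
  rw [B0.mul_f_self_apply, B0.f_self_mul_apply, B0.smul_apply]
  by_cases hp : p = x <;> by_cases hq : q = y <;> simp [B0.f, hp, hq]

theorem idem_mul_mul_idem_mem (b : BS k S) :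
    idemElt S x * b * idemElt S y ∈ component S x y := by
  induction b using TensorProduct.induction_on with
  | zero => simp
  | add a b ha hb =>
    rw [mul_add, add_mul]
    exact Submodule.add_mem _ ha hb
  | tmul b c =>
    obtain ⟨a, rfl⟩ := toB_surjective b
    rw [Algebra.TensorProduct.tmul_mul_tmul, Algebra.TensorProduct.tmul_mul_tmul, one_mul, mul_one,
      toB_f_mul_mul]
    have hc : c ∈ Submodule.span (ZMod 2) (Set.range (extMon (S := S))) := by
      rw [span_extMon]
      trivial
    induction a x y using MvPolynomial.induction_on' with
    | add p q hp hq =>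
      rw [add_smul, map_add, TensorProduct.add_tmul]
      exact Submodule.add_mem _ hp hq
    | monomial e r =>
      have hr : MvPolynomial.monomial e r = r • MvPolynomial.monomial e (1 : ZMod 2) := by
        rw [MvPolynomial.smul_monomial, smul_eq_mul, mul_one]
      rw [hr, toB_smul, ← TensorProduct.smul_tmul']
      refine Submodule.smul_mem _ _ ?_
      change bMon x y e ⊗ₜ c ∈ _
      by_cases he : Survives x y e
      · induction hc using Submodule.span_induction with
        | mem c hc =>
          obtain ⟨σ, rfl⟩ := hc
          have hE : e + lineExp σ - lineExp σ = e := add_tsub_cancel_right _ _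
          have : bMon x y e ⊗ₜ extMon σ = mon x y (e + lineExp σ) σ := by
            rw [mon, hE]
          rw [this]
          refine mon_mem_component ⟨fun i hi => ?_, by rwa [hE]⟩
          rw [Finsupp.add_apply, lineExp_apply, if_pos hi]
          omega
        | zero => simp
        | add a b _ _ ha hb =>
          rw [TensorProduct.tmul_add]
          exact Submodule.add_mem _ ha hb
        | smul r a _ ha =>
          rw [TensorProduct.tmul_smul]
          exact Submodule.smul_mem _ _ ha
      · rw [bMon_eq_zero he, TensorProduct.zero_tmul]
        exact Submodule.zero_mem _

theorem idem_mul_mul_idem_of_mem {b : BS k S} (hb : b ∈ component S x y) :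
    idemElt S x * b * idemElt S y = b := by
  induction hb using Submodule.span_induction with
  | mem m hm =>
    obtain ⟨g, σ, -, rfl⟩ := hm
    rw [mon, bMon, Algebra.TensorProduct.tmul_mul_tmul, Algebra.TensorProduct.tmul_mul_tmul,
      one_mul, mul_one, toB_f_mul_mul]
    simp [B0.f]
  | zero => simp
  | add a b _ _ ha hb => rw [mul_add, add_mul, ha, hb]
  | smul r a _ ha => rw [mul_smul_comm, smul_mul_assoc, ha]

theorem d_idem_mul_mul_idem (b : BS k S) :
    d k S (idemElt S x * b * idemElt S y) = idemElt S x * d k S b * idemElt S y := by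
  rw [d_mul, d_mul, d_B, d_B, zero_mul, zero_add, mul_zero, add_zero]

theorem d_mem_component {b : BS k S} (hb : b ∈ component S x y) :
    d k S b ∈ component S x y := by
  rw [← idem_mul_mul_idem_of_mem hb, d_idem_mul_mul_idem]
  exact idem_mul_mul_idem_mem _

theorem mem_span_mon_of_coef_ne_zero (hfar : ¬ Far x y) {w : BS k S} (hw : w ∈ component S x y) :
    w ∈ Submodule.span (ZMod 2) {m | ∃ g σ, coef x y g σ w ≠ 0 ∧ m = mon x y g σ} := by
  classical
  let Ω := {q : (Fin n →₀ ℕ) × Finset S // Allowed x y q.1 q.2}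
  have hspan : component S x y =
      Submodule.span (ZMod 2) (Set.range fun q : Ω => mon x y q.1.1 q.1.2) := by
    rw [component]
    congr 1
    ext m
    constructor
    · rintro ⟨g, σ, h, rfl⟩
      exact ⟨⟨(g, σ), h⟩, rfl⟩
    · rintro ⟨q, rfl⟩
      exact ⟨q.1.1, q.1.2, q.2, rfl⟩
  rw [hspan, Finsupp.mem_span_range_iff_exists_finsupp] at hw
  obtain ⟨c, hc⟩ := hw
  have hcoef : ∀ q : Ω, coef x y q.1.1 q.1.2 w = c q := by
    intro q
    rw [← hc, Finsupp.sum, map_sum]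
    simp only [map_smul, smul_eq_mul]
    have : ∀ q' : Ω, coef x y q.1.1 q.1.2 (mon x y q'.1.1 q'.1.2) = if q = q' then 1 else 0 := by
      intro q'
      rw [coef_mon hfar _ _ q'.2]
      exact if_congr (Subtype.ext_iff.trans Prod.ext_iff).symm rfl rfl
    simp only [this, mul_ite, mul_one, mul_zero]
    rw [Finset.sum_ite_eq]
    split_ifs with h
    · rfl
    · exact (Finsupp.notMem_support_iff.1 h).symm
  rw [← hc]
  refine Submodule.sum_mem _ fun q hq => Submodule.smul_mem _ _ (Submodule.subset_span ?_)
  refine ⟨q.1.1, q.1.2, ?_, rfl⟩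
  rw [hc, hcoef]
  exact Finsupp.mem_support_iff.1 hq

theorem eq_zero_of_coef_eq_zero (hfar : ¬ Far x y) {w : BS k S} (hw : w ∈ component S x y)
    (h : ∀ g σ, coef x y g σ w = 0) : w = 0 := by
  have := mem_span_mon_of_coef_ne_zero hfar hw
  simpa [h] using this

end

section

variable {n k : ℕ} {S : Finset (Fin n)} {x y : IState n k}

/-! ### Reduction of cycles to normal form -/

/-- Distinct generating intervals have no line in common. -/
theorem GenInterval.eq_of_mem {G G' : GenInterval x y} {t : Fin n} (h : t ∈ G.lines)
    (h' : t ∈ G'.lines) : G = G' := by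
  have h1 := mem_lines.1 h
  have h2 := mem_lines.1 h'
  have key : ∀ {G G' : GenInterval x y}, (G.j : ℕ) ≤ t ∧ (t : ℕ) < G.m →
      (G'.j : ℕ) ≤ t ∧ (t : ℕ) < G'.m → G.j ≤ G'.j ∧ G.m ≤ G'.m := by
    intro G G' h1 h2
    constructor
    · by_contra hlt
      rw [not_le] at hlt
      exact G.left_not_used (G'.used _ hlt (by rw [Fin.lt_def]; omega))
    · by_contra hlt
      rw [not_le] at hlt
      exact G'.right_not_used (G.used _ (by rw [Fin.lt_def]; omega) hlt)
  exact GenInterval.ext (le_antisymm (key h1 h2).1 (key h2 h1).1)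
    (le_antisymm (key h1 h2).2 (key h2 h1).2)

theorem lineExp_erase_of_ne (σ : Finset S) (c : S) {t : Fin n} (ht : t ≠ c) :
    lineExp (σ.erase c) t = lineExp σ t := by
  by_cases hS : t ∈ S
  · have h1 := lineExp_apply σ ⟨t, hS⟩
    have h2 := lineExp_apply (σ.erase c) ⟨t, hS⟩
    have : (⟨t, hS⟩ : S) ≠ c := fun e => ht (congrArg Subtype.val e)
    rw [h1, h2]
    simp [this]
  · rw [lineExp_apply_of_notMem _ hS, lineExp_apply_of_notMem _ hS]

theorem lineExp_insert_of_ne (σ : Finset S) (c : S) {t : Fin n} (ht : t ≠ c) :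
    lineExp (insert c σ) t = lineExp σ t := by
  rw [← lineExp_erase_of_ne (insert c σ) c ht, ← lineExp_erase_of_ne σ c ht,
    Finset.erase_insert_eq_erase]

theorem not_survives_iff (g e : Fin n →₀ ℕ) :
    ¬ Survives x y (g - e) ↔ ∃ G : GenInterval x y, ∀ t ∈ G.lines, e t < g t := by
  simp only [Survives, Finsupp.tsub_apply, not_forall, not_exists, not_and]
  refine exists_congr fun G => forall₂_congr fun t _ => by omega

/-- A variable `C_c` cannot be removed from an allowed set only for the reason that `U_c` would
complete the monomial `p_G` of the generating interval `G` containing the line `c`. -/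
theorem Allowed.exists_of_not_erase {g : Fin n →₀ ℕ} {τ : Finset S} {c : S}
    (h : Allowed x y g τ) (hc : c ∈ τ) (h' : ¬ Allowed x y g (τ.erase c)) :
    ∃ G : GenInterval x y, (c : Fin n) ∈ G.lines ∧ g c = 1 ∧
      ∀ t ∈ G.lines, lineExp (τ.erase c) t < g t := by
  have h1 : ¬ Survives x y (g - lineExp (τ.erase c)) :=
    fun hs => h' ⟨fun i hi => h.1 i (Finset.mem_of_mem_erase hi), hs⟩
  obtain ⟨G, hG⟩ := (not_survives_iff _ _).1 h1
  obtain ⟨t, ht, ht0⟩ := h.2 G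
  rw [Finsupp.tsub_apply] at ht0
  have htc : t = c := by
    by_contra hne
    have := hG t ht
    rw [lineExp_erase_of_ne τ c hne] at this
    omega
  subst htc
  have h2 := h.1 c hc
  have h3 := lineExp_le_one τ c
  exact ⟨G, ht, by omega, hG⟩

theorem not_allowed_of_lt {g : Fin n →₀ ℕ} {τ : Finset S} (G : GenInterval x y)
    (h : ∀ t ∈ G.lines, lineExp τ t < g t) : ¬ Allowed x y g τ :=
  fun h' => (not_survives_iff _ _).2 ⟨G, h⟩ h'.2

/-- The homotopy `C_c / U_c`, restricted to the multidegrees satisfying `D`. -/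
theorem exists_homotopy (hfar : ¬ Far x y) (c : S) (D : (Fin n →₀ ℕ) → Prop)
    (hD : ∀ g, D g → g c ≠ 0) {w : BS k S} (hw : w ∈ component S x y) :
    ∃ v ∈ component S x y,
      (∀ g σ, D g → c ∈ σ → Allowed x y g σ → coef x y g σ v = coef x y g (σ.erase c) w) ∧
      ∀ g σ, ¬ (D g ∧ c ∈ σ) → coef x y g σ v = 0 := by
  classical
  induction hw using Submodule.span_induction with
  | mem m hm =>
    obtain ⟨g₀, σ₀, h₀, rfl⟩ := hm
    by_cases h : D g₀ ∧ c ∉ σ₀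
    · have h₁ := (allowed_insert_iff h₀ c).2 (hD _ h.1)
      refine ⟨mon x y g₀ (insert c σ₀), mon_mem_component h₁, fun g σ hg hc hσ => ?_,
        fun g σ hg => ?_⟩
      · rw [coef_mon hfar _ _ h₁, coef_mon hfar _ _ h₀]
        refine if_congr (and_congr_right fun _ => ?_) rfl rfl
        constructor
        · rintro rfl
          exact Finset.erase_insert h.2
        · rintro rfl
          exact (Finset.insert_erase hc).symm
      · rw [coef_mon hfar _ _ h₁, if_neg]
        rintro ⟨rfl, rfl⟩
        exact hg ⟨h.1, Finset.mem_insert_self _ _⟩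
    · refine ⟨0, Submodule.zero_mem _, fun g σ hg hc hσ => ?_, fun g σ hg => map_zero _⟩
      rw [map_zero, coef_mon hfar _ _ h₀, if_neg]
      rintro ⟨rfl, rfl⟩
      exact h ⟨hg, Finset.notMem_erase _ _⟩
  | zero => exact ⟨0, Submodule.zero_mem _, by simp, by simp⟩
  | add a b _ _ ha hb =>
    obtain ⟨v, hv, hv1, hv2⟩ := ha
    obtain ⟨v', hv', hv1', hv2'⟩ := hb
    refine ⟨v + v', Submodule.add_mem _ hv hv', fun g σ h1 h2 h3 => ?_, fun g σ h => ?_⟩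
    · rw [map_add, map_add, hv1 g σ h1 h2 h3, hv1' g σ h1 h2 h3]
    · rw [map_add, hv2 g σ h, hv2' g σ h, add_zero]
  | smul r a _ ha =>
    obtain ⟨v, hv, hv1, hv2⟩ := ha
    refine ⟨r • v, Submodule.smul_mem _ r hv, fun g σ h1 h2 h3 => ?_, fun g σ h => ?_⟩
    · rw [map_smul, map_smul, hv1 g σ h1 h2 h3]
    · rw [map_smul, hv2 g σ h, smul_zero]

theorem zmod_add_self (a : ZMod 2) : a + a = 0 := CharTwo.add_self_eq_zero a

/-- Adding to a cycle the boundary of its image under the homotopy `C_c / U_c`, restricted to the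
multidegrees satisfying `D`, leaves in these multidegrees only terms that contain `C_c` and from
which it cannot be removed. -/
theorem exists_reduction_step (hfar : ¬ Far x y) (c : S) (D : (Fin n →₀ ℕ) → Prop)
    (hD : ∀ g, D g → g c ≠ 0) {w : BS k S} (hw : w ∈ component S x y) (hdw : d k S w = 0) :
    ∃ v ∈ component S x y, ∀ g τ, coef x y g τ (w + d k S v) ≠ 0 →
      (¬ D g ∧ coef x y g τ w ≠ 0) ∨
      (D g ∧ c ∈ τ ∧ ¬ Allowed x y g (τ.erase c) ∧ (coef x y g τ w ≠ 0 ∨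
        ∃ j ∉ τ, coef x y g (insert j (τ.erase c)) w ≠ 0)) := by
  classical
  obtain ⟨v, hv, hv1, hv2⟩ := exists_homotopy hfar c D hD hw
  refine ⟨v, hv, fun g τ hne => ?_⟩
  have hτ := Allowed.of_coef_ne_zero hne
  rw [map_add, coef_d hfar hτ] at hne
  by_cases hg : D g
  swap
  · left
    rw [Finset.sum_eq_zero, add_zero] at hne
    · exact ⟨hg, hne⟩
    · exact fun j _ => hv2 _ _ fun h => hg h.1
  right
  by_cases hc : c ∈ τ
  swap
  · exfalso
    apply hne
    rw [Finset.sum_eq_single c, hv1 g _ hg (Finset.mem_insert_self _ _)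
      ((allowed_insert_iff hτ c).2 (hD g hg)), Finset.erase_insert hc, zmod_add_self]
    · intro j _ hj
      exact hv2 _ _ fun h => hc ((Finset.mem_insert.1 h.2).resolve_left (Ne.symm hj))
    · intro h
      simp [hc] at h
  have hsum : ∑ j ∈ Finset.univ \ τ, coef x y g (insert j τ) v =
      ∑ j ∈ Finset.univ \ τ, coef x y g (insert j (τ.erase c)) w := by
    refine Finset.sum_congr rfl fun j hj => ?_
    have hjc : j ≠ c := by
      rintro rfl
      exact (Finset.mem_sdiff.1 hj).2 hc
    by_cases ha : Allowed x y g (insert j τ)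
    · rw [hv1 g _ hg (Finset.mem_insert_of_mem hc) ha, Finset.erase_insert_of_ne hjc]
    · rw [coef_eq_zero ha, LinearMap.zero_apply]
      by_contra hne'
      have h2 := Allowed.of_coef_ne_zero (Ne.symm hne')
      apply ha
      rw [allowed_insert_iff hτ]
      exact h2.1 j (Finset.mem_insert_self _ _)
  rw [hsum] at hne
  refine ⟨hg, hc, fun hal => hne ?_, ?_⟩
  · have h0 : coef x y g (τ.erase c) (d k S w) = 0 := by rw [hdw, map_zero]
    rw [coef_d hfar hal] at h0
    have hset : Finset.univ \ τ.erase c = insert c (Finset.univ \ τ) := by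
      ext j
      by_cases hj : j = c <;> simp [hj]
    rw [hset, Finset.sum_insert (by simp [hc]), Finset.insert_erase hc] at h0
    exact h0
  · by_contra hcon
    push Not at hcon
    apply hne
    rw [hcon.1, zero_add]
    exact Finset.sum_eq_zero fun j hj => hcon.2 j (Finset.mem_sdiff.1 hj).2

variable (i : MeetingInterval S x y → S)

/-- The multidegrees in which the homotopy `C_c / U_c` is used: those in which `U_c` or `C_c`
occurs, unless `c` is a line other than `i_G` in a generating interval `G`, the degree is `1` at
`c`, and it is positive throughout `G`. -/
def Toggles (c : S) (g : Fin n →₀ ℕ) : Prop :=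
  g c ≠ 0 ∧ ¬ ∃ G : MeetingInterval S x y, (c : Fin n) ∈ G.1.lines ∧ c ≠ i G ∧ g c = 1 ∧
    ∀ t ∈ G.1.lines, g t ≠ 0

variable {i}

theorem Toggles.eq_choice {c : S} {g : Fin n →₀ ℕ} (h : Toggles i c g) {G : GenInterval x y}
    (hc : (c : Fin n) ∈ G.lines) (h1 : g c = 1) (hG : ∀ t ∈ G.lines, g t ≠ 0) :
    ∃ hm : (G.lines ∩ S).Nonempty, c = i ⟨G, hm⟩ := by
  have hm : (G.lines ∩ S).Nonempty := ⟨c, Finset.mem_inter.2 ⟨hc, c.2⟩⟩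
  refine ⟨hm, ?_⟩
  by_contra hne
  exact h.2 ⟨⟨G, hm⟩, hc, hne, h1, hG⟩

/-- A later reduction step does not undo an earlier one. -/
theorem not_allowed_erase_of_toggles {g : Fin n →₀ ℕ} {τ : Finset S} {c c' j : S}
    (hc : Toggles i c g) (hc' : Toggles i c' g) (hτ : Allowed x y g τ) (hcτ : c ∈ τ)
    (hτc : ¬ Allowed x y g (τ.erase c)) (hj : j ∉ τ)
    (hσ : Allowed x y g (insert j (τ.erase c))) (hcσ : c' ∈ insert j (τ.erase c))
    (hσc : ¬ Allowed x y g ((insert j (τ.erase c)).erase c')) :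
    c' ∈ τ ∧ ¬ Allowed x y g (τ.erase c') := by
  obtain ⟨G, hcG, hgc, hG⟩ := hτ.exists_of_not_erase hcτ hτc
  obtain ⟨G', hcG', hgc', hG'⟩ := hσ.exists_of_not_erase hcσ hσc
  have hG0 : ∀ t ∈ G.lines, g t ≠ 0 := fun t ht => by
    have := hG t ht
    omega
  have hjc : j ≠ c := by
    rintro rfl
    exact hj hcτ
  obtain ⟨hm, hci⟩ := hc.eq_choice hcG hgc hG0
  have hjG : (j : Fin n) ∈ G.lines := by
    obtain ⟨t, ht, ht0⟩ := hσ.2 G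
    rw [Finsupp.tsub_apply] at ht0
    have : t = j := by
      by_contra hne
      have := hG t ht
      rw [lineExp_insert_of_ne _ _ hne] at ht0
      omega
    rwa [← this]
  have hc'G : (c' : Fin n) ∈ G.lines → c' = c := by
    intro h
    obtain ⟨_, hci'⟩ := hc'.eq_choice h hgc' hG0
    rw [hci, hci']
  have hc'j : c' ≠ j := by
    rintro rfl
    exact hjc (hc'G hjG)
  have hmem := (Finset.mem_insert.1 hcσ).resolve_left hc'j
  refine ⟨Finset.mem_of_mem_erase hmem, not_allowed_of_lt G' fun t ht => ?_⟩
  have hGG : ∀ s ∈ G.lines, s ∉ G'.lines := by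
    intro s hs hs'
    obtain rfl := GenInterval.eq_of_mem hs hs'
    exact Finset.ne_of_mem_erase hmem (hc'G hcG')
  have htj : t ≠ j := fun h => hGG j hjG (h ▸ ht)
  have htc : t ≠ c := fun h => hGG c hcG (h ▸ ht)
  have := hG' t ht
  by_cases htc' : t = c'
  · subst htc'
    rw [lineExp_apply] at this ⊢
    simpa using this
  · rw [lineExp_erase_of_ne _ _ htc', lineExp_insert_of_ne _ _ htj,
      lineExp_erase_of_ne _ _ htc] at this
    rwa [lineExp_erase_of_ne _ _ htc']

theorem exists_reduction (hfar : ¬ Far x y) {w : BS k S} (hw : w ∈ component S x y)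
    (hdw : d k S w = 0) (T : Finset S) :
    ∃ v ∈ component S x y, ∀ g τ, coef x y g τ (w + d k S v) ≠ 0 →
      ∀ c ∈ T, Toggles i c g → c ∈ τ ∧ ¬ Allowed x y g (τ.erase c) := by
  classical
  induction T using Finset.induction_on with
  | empty => exact ⟨0, Submodule.zero_mem _, by simp⟩
  | insert c T _ ih =>
    obtain ⟨v, hv, hv'⟩ := ih
    obtain ⟨u, hu, hu'⟩ := exists_reduction_step hfar c (Toggles i c) (fun g h => h.1)
      (Submodule.add_mem _ hw (d_mem_component hv)) (by rw [map_add, hdw, d_d, add_zero])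
    refine ⟨v + u, Submodule.add_mem _ hv hu, fun g τ hne c' hc' ht => ?_⟩
    rw [map_add (d k S), ← add_assoc] at hne
    have hτ := Allowed.of_coef_ne_zero hne
    rcases hu' g τ hne with ⟨hg, h1⟩ | ⟨hg, h1, h2, h3⟩
    · rcases Finset.mem_insert.1 hc' with rfl | hc'
      · exact (hg ht).elim
      · exact hv' g τ h1 c' hc' ht
    · rcases Finset.mem_insert.1 hc' with rfl | hc'
      · exact ⟨h1, h2⟩
      · rcases h3 with h3 | ⟨j, hj, h3⟩
        · exact hv' g τ h3 c' hc' ht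
        · have h4 := hv' g _ h3 c' hc' ht
          exact not_allowed_erase_of_toggles hg ht hτ h1 h2 hj (Allowed.of_coef_ne_zero h3)
            h4.1 h4.2

end

section

variable {n k : ℕ} {S : Finset (Fin n)} {x y : IState n k}
  {i : MeetingInterval S x y → S}

/-! ### The basis cycles -/

variable (i) in
/-- The lines `i_G` for `G` in a set of generating intervals: the variables `C_i` occurring in a
basis cycle. -/
def choiceSet (E : Finset (MeetingInterval S x y)) : Finset S := by
  classical
  exact E.image i

/-- The exponent vector of the product of the monomials `p_G` over a set of generating
intervals. -/
def intervalExp (E : Finset (MeetingInterval S x y)) : Fin n →₀ ℕ :=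
  ∑ G ∈ E, ∑ t ∈ G.1.lines, Finsupp.single t 1

theorem intervalExp_eq_one {E : Finset (MeetingInterval S x y)} {G : MeetingInterval S x y}
    (hG : G ∈ E) {t : Fin n} (ht : t ∈ G.1.lines) : intervalExp E t = 1 := by
  classical
  rw [intervalExp, Finsupp.finsetSum_apply, Finset.sum_eq_single G]
  · rw [sum_single_one_apply, if_pos ht]
  · intro G' _ hne
    rw [sum_single_one_apply, if_neg]
    exact fun h => hne (Subtype.ext (GenInterval.eq_of_mem h ht))
  · exact fun h => (h hG).elim

theorem intervalExp_eq_zero {E : Finset (MeetingInterval S x y)} {t : Fin n}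
    (ht : ∀ G ∈ E, t ∉ G.1.lines) : intervalExp E t = 0 := by
  classical
  rw [intervalExp, Finsupp.finsetSum_apply]
  refine Finset.sum_eq_zero fun G hG => ?_
  rw [sum_single_one_apply, if_neg (ht G hG)]

theorem mem_choiceSet {E : Finset (MeetingInterval S x y)} {c : S} :
    c ∈ choiceSet i E ↔ ∃ G ∈ E, i G = c := by
  simp [choiceSet]

theorem choice_injective (hi : ∀ G, (i G : Fin n) ∈ G.1.lines) : Function.Injective i :=
  fun G G' h => Subtype.ext (GenInterval.eq_of_mem (hi G) (h ▸ hi G'))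

theorem card_choiceSet (hi : ∀ G, (i G : Fin n) ∈ G.1.lines)
    (E : Finset (MeetingInterval S x y)) : (choiceSet i E).card = E.card := by
  classical
  exact Finset.card_image_of_injective E (choice_injective hi)

theorem lineExp_choiceSet (hi : ∀ G, (i G : Fin n) ∈ G.1.lines)
    (E : Finset (MeetingInterval S x y)) :
    lineExp (choiceSet i E) = ∑ G ∈ E, Finsupp.single (i G : Fin n) 1 := by
  classical
  exact Finset.sum_image fun G _ G' _ h => choice_injective hi h

theorem prod_tmul_prod {ι : Type*} (s : Finset ι) (p : ι → PolyU n) (c : ι → Ext S) :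
    ∏ a ∈ s, (p a ⊗ₜ[ZMod 2] c a) = (∏ a ∈ s, p a) ⊗ₜ ∏ a ∈ s, c a := by
  classical
  induction s using Finset.induction_on with
  | empty => rfl
  | insert a s ha ih =>
    rw [Finset.prod_insert ha, Finset.prod_insert ha, Finset.prod_insert ha, ih,
      Algebra.TensorProduct.tmul_mul_tmul]

namespace BasisIndex

open Classical in
/-- The set of generating intervals `G` with `ε_G = 1`. -/
def active (q : BasisIndex S x y) : Finset (MeetingInterval S x y) :=
  Finset.univ.filter fun G => q.ε G = 1

/-- The multidegree of a basis cycle. -/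
def deg (q : BasisIndex S x y) : Fin n →₀ ℕ := q.e + intervalExp q.active

theorem mem_active {q : BasisIndex S x y} {G : MeetingInterval S x y} :
    G ∈ q.active ↔ q.ε G = 1 := by
  simp [active]

theorem survives (q : BasisIndex S x y) : Survives x y q.e := (survives_iff q.e).2 q.not_dvd

theorem deg_eq_one {q : BasisIndex S x y} {G : MeetingInterval S x y} (hG : G ∈ q.active) {c : S}
    (hc : (c : Fin n) ∈ G.1.lines) : q.deg c = 1 := by
  rw [deg, Finsupp.add_apply, q.e_eq_zero c c.2, intervalExp_eq_one hG hc]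

theorem deg_ne_zero {q : BasisIndex S x y} {G : MeetingInterval S x y} (hG : G ∈ q.active)
    {t : Fin n} (ht : t ∈ G.1.lines) : q.deg t ≠ 0 := by
  rw [deg, Finsupp.add_apply, intervalExp_eq_one hG ht]
  omega

theorem deg_eq_zero {q : BasisIndex S x y} {c : S}
    (hc : ∀ G ∈ q.active, (c : Fin n) ∉ G.1.lines) : q.deg c = 0 := by
  rw [deg, Finsupp.add_apply, q.e_eq_zero c c.2, intervalExp_eq_zero hc]

theorem deg_choice (hi : ∀ G, (i G : Fin n) ∈ G.1.lines) (q : BasisIndex S x y)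
    (G : MeetingInterval S x y) : q.deg (i G) = (q.ε G : ℕ) := by
  by_cases hG : G ∈ q.active
  · rw [deg_eq_one hG (hi G), mem_active.1 hG]
    rfl
  · have h0 : q.ε G = 0 := by
      rw [mem_active] at hG
      omega
    rw [deg_eq_zero, h0]
    · rfl
    · intro G' hG' h
      exact hG (Subtype.ext (GenInterval.eq_of_mem h (hi G)) ▸ hG')

theorem deg_injective (hi : ∀ G, (i G : Fin n) ∈ G.1.lines) :
    Function.Injective (deg : BasisIndex S x y → _) := by
  intro q q' h
  have hε : q.ε = q'.ε := by
    ext G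
    rw [← q.deg_choice hi, ← q'.deg_choice hi, h]
  have ha : q.active = q'.active := by
    ext G
    rw [mem_active, mem_active, hε]
  have he : q.e = q'.e := by
    rw [deg, deg, ha] at h
    exact add_right_cancel h
  cases q
  cases q'
  simp only at hε he
  subst hε he
  rfl

/-- In the multidegree of a basis cycle, the allowed sets are the sets of lines in the active
generating intervals that meet each of these intervals. -/
theorem allowed_deg_iff (q : BasisIndex S x y) (τ : Finset S) :
    Allowed x y q.deg τ ↔ (∀ c ∈ τ, ∃ G ∈ q.active, (c : Fin n) ∈ G.1.lines) ∧
      ∀ G ∈ q.active, ∃ c ∈ τ, (c : Fin n) ∈ G.1.lines := by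
  constructor
  · intro h
    constructor
    · intro c hc
      by_contra hcon
      push Not at hcon
      exact h.1 c hc (deg_eq_zero hcon)
    · intro G hG
      obtain ⟨t, ht, ht0⟩ := h.2 G.1
      rw [Finsupp.tsub_apply] at ht0
      have h1 := deg_ne_zero hG ht
      have htS : t ∈ S := by
        by_contra htS
        rw [lineExp_apply_of_notMem _ htS] at ht0
        omega
      refine ⟨⟨t, htS⟩, ?_, ht⟩
      by_contra hτ
      have h2 := lineExp_apply τ ⟨t, htS⟩
      rw [if_neg hτ] at h2
      simp only at h2
      omega
  · rintro ⟨h1, h2⟩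
    refine ⟨fun c hc => ?_, fun G => ?_⟩
    · obtain ⟨G, hG, hcG⟩ := h1 c hc
      exact deg_ne_zero hG hcG
    · by_cases hG : ∃ G' ∈ q.active, G'.1 = G
      · obtain ⟨G', hG', rfl⟩ := hG
        obtain ⟨c, hc, hcG⟩ := h2 G' hG'
        refine ⟨c, hcG, ?_⟩
        rw [Finsupp.tsub_apply, deg_eq_one hG' hcG, lineExp_apply, if_pos hc]
      · push Not at hG
        obtain ⟨t, ht, ht0⟩ := q.survives G
        refine ⟨t, ht, ?_⟩
        rw [Finsupp.tsub_apply, deg, Finsupp.add_apply, ht0, intervalExp_eq_zero, zero_add,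
          zero_tsub]
        exact fun G' hG' h => hG G' hG' (GenInterval.eq_of_mem h ht)

theorem allowed_choiceSet (hi : ∀ G, (i G : Fin n) ∈ G.1.lines) (q : BasisIndex S x y) :
    Allowed x y q.deg (choiceSet i q.active) := by
  rw [allowed_deg_iff]
  constructor
  · intro c hc
    obtain ⟨G, hG, rfl⟩ := mem_choiceSet.1 hc
    exact ⟨G, hG, hi G⟩
  · exact fun G hG => ⟨i G, mem_choiceSet.2 ⟨G, hG, rfl⟩, hi G⟩

theorem deg_sub_lineExp (hi : ∀ G, (i G : Fin n) ∈ G.1.lines) (q : BasisIndex S x y) :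
    q.deg - lineExp (choiceSet i q.active) =
      q.e + ∑ G ∈ q.active, ∑ t ∈ G.1.lines.erase (i G), Finsupp.single t 1 := by
  have h : intervalExp q.active = ∑ G ∈ q.active, ∑ t ∈ G.1.lines.erase (i G),
      Finsupp.single t 1 + lineExp (choiceSet i q.active) := by
    rw [lineExp_choiceSet hi, ← Finset.sum_add_distrib, intervalExp]
    exact Finset.sum_congr rfl fun G _ => (Finset.sum_erase_add _ _ (hi G)).symm
  rw [deg, h, ← add_assoc, add_tsub_cancel_right]

end BasisIndex

theorem φ_tmul (p : PolyU n) (c : Ext S) :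
    φ S x y (p ⊗ₜ c) = toB n k (p • B0.f x y) ⊗ₜ c := by
  rfl

theorem basisElt_eq_mon (hi : ∀ G, (i G : Fin n) ∈ G.1.lines) (q : BasisIndex S x y) :
    basisElt i q = mon x y q.deg (choiceSet i q.active) := by
  classical
  have hprod : ∏ G : MeetingInterval S x y, G.1.factor (i G) ^ (q.ε G : ℕ) =
      ∏ G ∈ q.active, G.1.factor (i G) := by
    rw [BasisIndex.active, Finset.prod_filter]
    refine Finset.prod_congr rfl fun G _ => ?_
    split_ifs with h
    · rw [h]
      exact pow_one _
    · rw [show q.ε G = 0 by omega]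
      exact pow_zero _
  rw [basisElt, hprod]
  simp only [GenInterval.factor]
  rw [prod_tmul_prod, Algebra.TensorProduct.tmul_mul_tmul, one_mul, φ_tmul, mon, bMon,
    q.deg_sub_lineExp hi]
  congr 1
  · congr 2
    rw [← one_mul (1 : ZMod 2), ← MvPolynomial.monomial_mul, one_mul,
      MvPolynomial.monomial_sum_one]
    congr 1
    refine Finset.prod_congr rfl fun G _ => ?_
    rw [MvPolynomial.monomial_sum_one]
    rfl
  · rw [extMon, choiceSet, Finset.prod_image fun G _ G' _ h => choice_injective hi h]

theorem basisElt_mem_component (hi : ∀ G, (i G : Fin n) ∈ G.1.lines) (q : BasisIndex S x y) :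
    basisElt i q ∈ component S x y := by
  rw [basisElt_eq_mon hi]
  exact mon_mem_component (q.allowed_choiceSet hi)

theorem basisElt_mem_cycles (hfar : ¬ Far x y) (hi : ∀ G, (i G : Fin n) ∈ G.1.lines)
    (q : BasisIndex S x y) : basisElt i q ∈ cycles k S := by
  rw [mem_cycles]
  refine eq_zero_of_coef_eq_zero hfar (d_mem_component (basisElt_mem_component hi q))
    fun g τ => ?_
  by_cases hτ : Allowed x y g τ
  swap
  · rw [coef_eq_zero hτ, LinearMap.zero_apply]
  rw [coef_d hfar hτ]
  refine Finset.sum_eq_zero fun c hc => ?_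
  rw [basisElt_eq_mon hi, coef_mon hfar _ _ (q.allowed_choiceSet hi), if_neg]
  rintro ⟨rfl, h⟩
  have hc' : c ∈ choiceSet i q.active := h ▸ Finset.mem_insert_self c τ
  obtain ⟨G, hG, rfl⟩ := mem_choiceSet.1 hc'
  -- The set `τ` still meets `G`, but `i_G` is the only line of `G` in the set of choices.
  obtain ⟨c', hc'τ, hc'G⟩ := ((q.allowed_deg_iff τ).1 hτ).2 G hG
  have h2 : c' ∈ choiceSet i q.active := h ▸ Finset.mem_insert_of_mem hc'τ
  obtain ⟨G', hG', rfl⟩ := mem_choiceSet.1 h2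
  have : G' = G := Subtype.ext (GenInterval.eq_of_mem (hi G') hc'G)
  subst this
  exact (Finset.mem_sdiff.1 hc).2 hc'τ

open Classical in
/-- The linear form dual to a basis cycle: the sum of the coefficients of all basis elements
of the same multidegree and the same number of variables `C_i`. -/
def dualForm (q : BasisIndex S x y) : BS k S →ₗ[ZMod 2] ZMod 2 :=
  ∑ τ ∈ Finset.univ.filter (fun τ : Finset S => τ.card = q.active.card), coef x y q.deg τ

open Classical in
theorem dualForm_basisElt (hfar : ¬ Far x y) (hi : ∀ G, (i G : Fin n) ∈ G.1.lines)
    (q q' : BasisIndex S x y) : dualForm q (basisElt i q') = if q = q' then 1 else 0 := by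
  rw [dualForm, LinearMap.sum_apply, basisElt_eq_mon hi]
  simp only [coef_mon hfar _ _ (q'.allowed_choiceSet hi), (BasisIndex.deg_injective hi).eq_iff]
  split_ifs with h
  · subst h
    simp only [true_and]
    rw [Finset.sum_ite_eq', if_pos]
    rw [Finset.mem_filter]
    exact ⟨Finset.mem_univ _, card_choiceSet hi _⟩
  · simp [h]

theorem BasisIndex.allowed_erase {q : BasisIndex S x y} {τ : Finset S}
    (h : Allowed x y q.deg τ) {a b : S} (hb : b ∈ τ) (hab : a ≠ b) {G : MeetingInterval S x y}
    (haG : (a : Fin n) ∈ G.1.lines) (hbG : (b : Fin n) ∈ G.1.lines) :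
    Allowed x y q.deg (τ.erase a) := by
  rw [allowed_deg_iff] at h ⊢
  refine ⟨fun c hc => h.1 c (Finset.mem_of_mem_erase hc), fun G' hG' => ?_⟩
  obtain ⟨c, hc, hcG⟩ := h.2 G' hG'
  by_cases hca : c = a
  · subst hca
    have : G = G' := Subtype.ext (GenInterval.eq_of_mem haG hcG)
    subst this
    exact ⟨b, Finset.mem_erase.2 ⟨hab.symm, hb⟩, hbG⟩
  · exact ⟨c, Finset.mem_erase.2 ⟨hca, hc⟩, hcG⟩

theorem BasisIndex.card_active_le {q : BasisIndex S x y} {τ : Finset S}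
    (h : Allowed x y q.deg τ) : q.active.card ≤ τ.card := by
  rw [allowed_deg_iff] at h
  rcases q.active.eq_empty_or_nonempty with h0 | ⟨G₀, hG₀⟩
  · simp [h0]
  have : Nonempty S := ⟨(h.2 G₀ hG₀).choose⟩
  choose! s hs hs' using h.2
  refine Finset.card_le_card_of_injOn s hs fun G hG G' hG' e => ?_
  exact Subtype.ext (GenInterval.eq_of_mem (hs' G hG) (e ▸ hs' G' hG'))

open Classical in
/-- From an allowed set with one element more than there are active intervals, exactly two elements
can be removed: those in the only interval that contains two of them. -/
theorem BasisIndex.card_filter_allowed_erase {q : BasisIndex S x y} {σ : Finset S}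
    (h : Allowed x y q.deg σ) (hcard : σ.card = q.active.card + 1) :
    (σ.filter fun c => Allowed x y q.deg (σ.erase c)).card = 2 := by
  have h' := ((q.allowed_deg_iff σ).1 h).1
  obtain ⟨c₀, hc₀⟩ : σ.Nonempty := Finset.card_pos.1 (by omega)
  have : Nonempty (MeetingInterval S x y) := ⟨(h' c₀ hc₀).choose⟩
  choose! s hs hs' using h'
  obtain ⟨a, ha, b, hb, hab, hsab⟩ := Finset.exists_ne_map_eq_of_card_lt_of_maps_to
    (by omega : q.active.card < σ.card) hs
  have haG := hs' a ha
  have hbG := hs' b hb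
  rw [← hsab] at hbG
  rw [Finset.card_eq_two]
  refine ⟨a, b, hab, ?_⟩
  ext c
  simp only [Finset.mem_filter, Finset.mem_insert, Finset.mem_singleton]
  constructor
  · rintro ⟨hc, hal⟩
    by_contra hne
    push Not at hne
    have ha' : a ∈ σ.erase c := Finset.mem_erase.2 ⟨hne.1.symm, ha⟩
    have hb' : b ∈ σ.erase c := Finset.mem_erase.2 ⟨hne.2.symm, hb⟩
    have h1 := card_active_le (allowed_erase hal hb' hab haG hbG)
    have h2 := Finset.card_erase_add_one ha'
    have h3 := Finset.card_erase_add_one hc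
    omega
  · rintro (rfl | rfl)
    · exact ⟨ha, allowed_erase h hb hab haG hbG⟩
    · exact ⟨hb, allowed_erase h ha hab.symm hbG haG⟩

/-- The dual forms vanish on boundaries: each coefficient of `u` contributes twice. -/
theorem dualForm_d (hfar : ¬ Far x y) (q : BasisIndex S x y) (u : BS k S) :
    dualForm q (d k S u) = 0 := by
  classical
  have h1 : dualForm q (d k S u) =
      ∑ τ ∈ Finset.univ.filter (fun τ : Finset S => τ.card = q.active.card),
        ∑ c ∈ Finset.univ \ τ,
          if Allowed x y q.deg τ then coef x y q.deg (insert c τ) u else 0 := by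
    rw [dualForm, LinearMap.sum_apply]
    refine Finset.sum_congr rfl fun τ _ => ?_
    by_cases hτ : Allowed x y q.deg τ
    · simp only [if_pos hτ]
      exact coef_d hfar hτ u
    · simp [hτ, coef_eq_zero hτ]
  have h2 : ∑ τ ∈ Finset.univ.filter (fun τ : Finset S => τ.card = q.active.card),
        ∑ c ∈ Finset.univ \ τ,
          (if Allowed x y q.deg τ then coef x y q.deg (insert c τ) u else 0) =
      ∑ σ ∈ Finset.univ.filter (fun σ : Finset S => σ.card = q.active.card + 1),
        ∑ c ∈ σ, if Allowed x y q.deg (σ.erase c) then coef x y q.deg σ u else 0 := by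
    rw [Finset.sum_sigma', Finset.sum_sigma']
    refine Finset.sum_bij' (fun a _ => ⟨insert a.2 a.1, a.2⟩) (fun a _ => ⟨a.1.erase a.2, a.2⟩)
      ?_ ?_ ?_ ?_ ?_
    · rintro ⟨τ, c⟩ h
      simp only [Finset.mem_sigma, Finset.mem_filter, Finset.mem_univ, true_and,
        Finset.mem_sdiff] at h ⊢
      exact ⟨by rw [Finset.card_insert_of_notMem h.2, h.1], Finset.mem_insert_self _ _⟩
    · rintro ⟨σ, c⟩ h
      simp only [Finset.mem_sigma, Finset.mem_filter, Finset.mem_univ, true_and,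
        Finset.mem_sdiff] at h ⊢
      refine ⟨?_, Finset.notMem_erase _ _⟩
      have := Finset.card_erase_add_one h.2
      omega
    · rintro ⟨τ, c⟩ h
      simp only [Finset.mem_sigma, Finset.mem_filter, Finset.mem_univ, true_and,
        Finset.mem_sdiff] at h
      simp [Finset.erase_insert h.2]
    · rintro ⟨σ, c⟩ h
      simp only [Finset.mem_sigma, Finset.mem_filter, Finset.mem_univ, true_and] at h
      simp [Finset.insert_erase h.2]
    · rintro ⟨τ, c⟩ h
      simp only [Finset.mem_sigma, Finset.mem_filter, Finset.mem_univ, true_and,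
        Finset.mem_sdiff] at h
      simp [Finset.erase_insert h.2]
  rw [h1, h2]
  refine Finset.sum_eq_zero fun σ hσ => ?_
  by_cases ha : Allowed x y q.deg σ
  · rw [← Finset.sum_filter, Finset.sum_const,
      BasisIndex.card_filter_allowed_erase ha (Finset.mem_filter.1 hσ).2, two_smul, zmod_add_self]
  · simp [coef_eq_zero ha]

/-- The terms that remain after the reduction of a cycle are the basis cycles. -/
theorem exists_basisElt_eq_mon (hi : ∀ G, (i G : Fin n) ∈ G.1.lines) {g : Fin n →₀ ℕ}
    {τ : Finset S} (hτ : Allowed x y g τ)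
    (h : ∀ c, Toggles i c g → c ∈ τ ∧ ¬ Allowed x y g (τ.erase c)) :
    ∃ q : BasisIndex S x y, mon x y g τ = basisElt i q := by
  classical
  let E : Finset (MeetingInterval S x y) :=
    Finset.univ.filter fun G => ∀ t ∈ G.1.lines, g t ≠ 0
  have hE : ∀ G : MeetingInterval S x y, G ∈ E ↔ ∀ t ∈ G.1.lines, g t ≠ 0 := fun G => by simp [E]
  -- The variable `C_{i_G}` occurs for each `G` in `E`.
  have hchoice : ∀ G ∈ E, i G ∈ τ ∧ ¬ Allowed x y g (τ.erase (i G)) := by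
    intro G hG
    refine h _ ⟨(hE G).1 hG _ (hi G), ?_⟩
    rintro ⟨G', hG', hne, -⟩
    exact hne (congrArg i (Subtype.ext (GenInterval.eq_of_mem (hi G) hG')))
  have hcases : ∀ c : S, g c ≠ 0 → ∃ G ∈ E, (c : Fin n) ∈ G.1.lines ∧ g c = 1 ∧
      (c ∈ τ → c = i G) := by
    intro c hc
    by_cases ht : Toggles i c g
    · obtain ⟨h1, h2⟩ := h c ht
      obtain ⟨G, hcG, hc1, hG⟩ := hτ.exists_of_not_erase h1 h2
      have hG0 : ∀ t ∈ G.lines, g t ≠ 0 := fun t ht => by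
        have := hG t ht
        omega
      obtain ⟨hm, hci⟩ := ht.eq_choice hcG hc1 hG0
      exact ⟨⟨G, hm⟩, (hE _).2 hG0, hcG, hc1, fun _ => hci⟩
    · rw [Toggles, not_and, not_not] at ht
      obtain ⟨G, hcG, hne, hc1, hG⟩ := ht hc
      refine ⟨G, (hE _).2 hG, hcG, hc1, fun hcτ => ?_⟩
      obtain ⟨h1, h2⟩ := hchoice G ((hE _).2 hG)
      obtain ⟨G', hiG', -, hG'⟩ := hτ.exists_of_not_erase h1 h2
      have hGG : G.1 = G' := GenInterval.eq_of_mem (hi G) hiG'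
      subst hGG
      have := hG' c hcG
      rw [lineExp_apply, if_pos (Finset.mem_erase.2 ⟨hne, hcτ⟩)] at this
      omega
  have hle : intervalExp E ≤ g := by
    intro t
    by_cases ht : ∃ G ∈ E, t ∈ G.1.lines
    · obtain ⟨G, hG, htG⟩ := ht
      rw [intervalExp_eq_one hG htG]
      have := (hE G).1 hG t htG
      omega
    · push Not at ht
      rw [intervalExp_eq_zero ht]
      exact Nat.zero_le _
  have he0 : ∀ t ∈ S, (g - intervalExp E) t = 0 := by
    intro t ht
    rw [Finsupp.tsub_apply]
    by_cases hg : g t = 0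
    · rw [hg, zero_tsub]
    · obtain ⟨G, hG, htG, h1, -⟩ := hcases ⟨t, ht⟩ hg
      rw [intervalExp_eq_one hG htG]
      simp only at h1
      omega
  let q : BasisIndex S x y :=
    { e := g - intervalExp E
      e_eq_zero := he0
      not_dvd := (survives_iff _).1 fun G => by
        by_cases hm : (G.lines ∩ S).Nonempty
        · obtain ⟨t, ht⟩ := hm
          exact ⟨t, (Finset.mem_inter.1 ht).1, he0 t (Finset.mem_inter.1 ht).2⟩
        · obtain ⟨t, ht, ht0⟩ := hτ.2 G
          refine ⟨t, ht, ?_⟩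
          have htS : t ∉ S := fun htS => hm ⟨t, Finset.mem_inter.2 ⟨ht, htS⟩⟩
          rw [Finsupp.tsub_apply, lineExp_apply_of_notMem _ htS] at ht0
          rw [Finsupp.tsub_apply]
          omega
      ε := fun G => if G ∈ E then 1 else 0 }
  have hactive : q.active = E := by
    ext G
    rw [BasisIndex.mem_active]
    simp [q]
  have hdeg : q.deg = g := by
    rw [BasisIndex.deg, hactive]
    exact tsub_add_cancel_of_le hle
  have hset : choiceSet i E = τ := by
    ext c
    rw [mem_choiceSet]
    constructor
    · rintro ⟨G, hG, rfl⟩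
      exact (hchoice G hG).1
    · intro hc
      obtain ⟨G, hG, -, -, h1⟩ := hcases c (hτ.1 c hc)
      exact ⟨G, hG, (h1 hc).symm⟩
  exact ⟨q, by rw [basisElt_eq_mon hi, hdeg, hactive, hset]⟩

/-- Every cycle is homologous to a linear combination of the basis cycles. -/
theorem exists_add_d_mem_span (hfar : ¬ Far x y) (hi : ∀ G, (i G : Fin n) ∈ G.1.lines)
    {w : BS k S} (hw : w ∈ component S x y) (hdw : d k S w = 0) :
    ∃ v, w + d k S v ∈ Submodule.span (ZMod 2) (Set.range (basisElt i)) := by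
  obtain ⟨v, hv, hred⟩ := exists_reduction (i := i) hfar hw hdw Finset.univ
  refine ⟨v, Submodule.span_mono ?_ (mem_span_mon_of_coef_ne_zero hfar
    (Submodule.add_mem _ hw (d_mem_component hv)))⟩
  rintro _ ⟨g, τ, hne, rfl⟩
  obtain ⟨q, hq⟩ := exists_basisElt_eq_mon hi (Allowed.of_coef_ne_zero hne)
    fun c hc => hred g τ hne c (Finset.mem_univ c) hc
  exact ⟨q, hq.symm⟩

/-! ### Homology -/

variable (k S) in
/-- The class of a cycle in the homology algebra, as a linear map. -/
def homologyClass : cycles k S →ₗ[ZMod 2] Homology k S :=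
  (Ideal.Quotient.mkₐ (ZMod 2) (boundaries k S)).toLinearMap

theorem homologyClass_eq_zero_iff (z : cycles k S) :
    homologyClass k S z = 0 ↔ ∃ u : BS k S, d k S u = z :=
  Ideal.Quotient.eq_zero_iff_mem

theorem mem_homologySummand_iff (h : Homology k S) :
    h ∈ homologySummand S x y ↔
      ∃ z : cycles k S, homologyClass k S (idem S x * z * idem S y) = h := by
  constructor
  · rintro ⟨c, rfl⟩
    obtain ⟨z, rfl⟩ := Ideal.Quotient.mk_surjective c
    refine ⟨z, ?_⟩
    rw [mul_assoc]
    rfl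
  · rintro ⟨z, rfl⟩
    refine ⟨homologyClass k S z, ?_⟩
    rw [mul_assoc]
    rfl

theorem homologySummand_eq_bot_of_far (h : Far x y) : homologySummand S x y = ⊥ := by
  rw [eq_bot_iff]
  intro c hc
  obtain ⟨z, rfl⟩ := (mem_homologySummand_iff c).1 hc
  have key : ∀ b : BS k S, idemElt S x * b * idemElt S y = 0 := by
    intro b
    induction b using TensorProduct.induction_on with
    | zero => simp
    | add a b ha hb => rw [mul_add, add_mul, ha, hb, add_zero]
    | tmul b c =>
      obtain ⟨a, rfl⟩ := toB_surjective b
      rw [Algebra.TensorProduct.tmul_mul_tmul, Algebra.TensorProduct.tmul_mul_tmul,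
        toB_f_mul_mul, (toB_eq_zero_iff _).2 (smul_mem_relIdeal _ h.f_mem_relIdeal),
        TensorProduct.zero_tmul]
  have : idem S x * z * idem S y = 0 := Subtype.ext (key z)
  rw [this, map_zero]
  exact Submodule.zero_mem _

theorem exists_basis_homologySummand (hfar : ¬ Far x y) (hi : ∀ G, (i G : Fin n) ∈ G.1.lines) :
    ∃ b : Module.Basis (BasisIndex S x y) (ZMod 2) (homologySummand S x y),
      ∀ q, (b q : Homology k S) =
        homologyClass k S ⟨basisElt i q, basisElt_mem_cycles hfar hi q⟩ := by
  classical
  let z : BasisIndex S x y → cycles k S :=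
    fun q => ⟨basisElt i q, basisElt_mem_cycles hfar hi q⟩
  have hz : ∀ q, homologyClass k S (z q) ∈ homologySummand S x y := fun q =>
    (mem_homologySummand_iff _).2 ⟨z q, congrArg _ (Subtype.ext
      (idem_mul_mul_idem_of_mem (basisElt_mem_component hi q)))⟩
  let v : BasisIndex S x y → homologySummand S x y := fun q => ⟨homologyClass k S (z q), hz q⟩
  have hli : LinearIndependent (ZMod 2) v := by
    rw [linearIndependent_iff']
    intro s c hc q hq
    have h1 : homologyClass k S (∑ q ∈ s, c q • z q) = 0 := by
      have := congrArg (Submodule.subtype _) hc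
      rw [map_sum, map_zero] at this
      rw [map_sum, ← this]
      exact Finset.sum_congr rfl fun q _ => by rw [map_smul, map_smul]; rfl
    obtain ⟨u, hu⟩ := (homologyClass_eq_zero_iff _).1 h1
    have h2 : d k S u = ∑ q ∈ s, c q • basisElt i q := by
      rw [hu]
      simp [z]
    have h3 := dualForm_d hfar q u
    rw [h2, map_sum] at h3
    simpa [dualForm_basisElt hfar hi, hq] using h3
  have hspan : ⊤ ≤ Submodule.span (ZMod 2) (Set.range v) := by
    rintro ⟨h, hh⟩ -
    obtain ⟨w, rfl⟩ := (mem_homologySummand_iff h).1 hh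
    have hcyc := (idem S x * w * idem S y).2
    obtain ⟨u, hu⟩ := exists_add_d_mem_span (i := i) hfar hi
      (idem_mul_mul_idem_mem (S := S) (x := x) (y := y) w) hcyc
    rw [Finsupp.mem_span_range_iff_exists_finsupp] at hu ⊢
    obtain ⟨c, hc⟩ := hu
    refine ⟨c, Subtype.ext ?_⟩
    have h1 : ((c.sum fun q r => r • v q : homologySummand S x y) : Homology k S) =
        homologyClass k S (c.sum fun q r => r • z q) := by
      rw [Finsupp.sum, Finsupp.sum, map_sum, AddSubmonoidClass.coe_finsetSum]
      exact Finset.sum_congr rfl fun q _ => by rw [map_smul]; rfl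
    rw [h1, ← sub_eq_zero, ← map_sub, homologyClass_eq_zero_iff]
    refine ⟨u, ?_⟩
    have h2 : ((c.sum fun q r => r • z q : cycles k S) : BS k S) =
        c.sum fun q r => r • basisElt i q := by
      rw [Finsupp.sum, Finsupp.sum, AddSubmonoidClass.coe_finsetSum]
      rfl
    rw [AddSubgroupClass.coe_sub, h2, hc]
    exact (add_sub_cancel_left _ _).symm
  exact ⟨Module.Basis.mk hli hspan, fun q => by rw [Module.Basis.mk_apply]⟩

end

end OSz

end

theorem mainTheorem3 (n k : ℕ) (S : Finset (Fin n)) (x y : OSz.IState n k) :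
    (¬ OSz.Far x y →
      ∀ i : OSz.MeetingInterval S x y → S, (∀ G, (i G : Fin n) ∈ G.1.lines) →
        ∃ b : Module.Basis (OSz.BasisIndex S x y) (ZMod 2) (OSz.homologySummand S x y),
          ∀ q, ∃ hq : OSz.basisElt i q ∈ OSz.cycles k S,
            (b q : OSz.Homology k S) =
              Ideal.Quotient.mk (OSz.boundaries k S) ⟨OSz.basisElt i q, hq⟩) ∧
    (OSz.Far x y → OSz.homologySummand S x y = ⊥) := by
  refine ⟨fun hfar i hi => ?_, OSz.homologySummand_eq_bot_of_far⟩
  obtain ⟨b, hb⟩ := OSz.exists_basis_homologySummand hfar hi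
  exact ⟨b, fun q => ⟨OSz.basisElt_mem_cycles hfar hi q, hb q⟩⟩
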